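/- **Problem.** Let $n\ge 2$, $d\ge 1$, let $A\in\mathbb R^{n\times d}$ have rows $A_1,\dots,A_n$ with $\|A_i\|\le 1$ (Euclidean norm), and let $\varepsilon>0$. Let $\sigma=\min_{x\in\mathbb R^d}\max_{i}\|x-A_i\|^2$ be the squared radius of the minimum enclosing ball of the rows. A point $x$ is an $\varepsilon$-approximate solution if $\max_i\|x-A_i\|^2\le\sigma+\varepsilon$. **Algorithm** (Sublinear Primal-Dual MEB, with a constant $c>0$). Let $T=\lceil c\,\varepsilon^{-2}\log n\rceil$, $\eta=\sqrt{(\log n)/T}$, $\alpha=\frac{\log T}{\sqrt{T\log n}}$, $w_1=(1,\dots,1)\in\mathbb R^n$, $y_1=x_1=0\in\mathbb R^d$, $m_1=0$. For $t=1,\dots,T$: 1. choose $i_t\in\{1,\dots,n\}$ with probability $p_t(i)=w_t(i)/\sum_k w_t(k)$; 2. with probability $\alpha$ set $y_{t+1}=y_t+A_{i_t}$, $m_{t+1}=m_t+1$, $x_{t+1}=y_{t+1}/m_{t+1}$; otherwise leave $y,m,x$ unchanged; 3. choose $j_t\in\{1,\dots,d\}$ with probability $x_t(j)^2/\|x_t\|^2$,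 and for every $i$ set $\tilde v_t(i)=-2A_i(j_t)\|x_t\|^2/x_t(j_t)+\|A_i\|^2+\|x_t\|^2$ (just $\tilde v_t(i)=\|A_i\|^2$ if $x_t=0$), $v_t(i)=\min\{1/\eta,\max\{-1/\eta,\tilde v_t(i)\}\}$ and $w_{t+1}(i)=w_t(i)\,(1+\eta v_t(i)+\eta^2v_t(i)^2)$. Return $\bar x=\frac1T\sum_{t=1}^T x_t$. **Theorem.** There are absolute constants $c,C>0$ and $k\in\mathbb N$ such that, for the algorithm with constant $c$ and for all $n,d,A,\varepsilon$ as above: * with probability at least $1/2$ the returned point $\bar x$ is an $\varepsilon$-approximate solution; * if $\varepsilon\le 1$, the number of iterations is $T\le C\,\varepsilon^{-2}\log n$; * the algorithm can be implemented by one fixed program (the same for all inputs, with exactly the same output distribution) whose expected running time, if $\varepsilon\le1$, is at most $$C\Bigl(\frac n{\varepsilon^2}+\frac d\varepsilon\Bigr)\Bigl(\log\frac{nd}{\varepsilon}\Bigr)^k=\tilde O\Bigl(\frac n{\varepsilon^2}+\frac d\varepsilon\Bigr).$$ The running time is the number of steps of a random access machine with exact real arithmetic (with square root and logarithm) that, in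 one step, performs one operation, reads one entry $A_i(j)$ or one known norm $\|A_i\|$ of the input, or tosses a coin of computed bias; rounding a real number $z$ up to an integer costs $1+\max\{\lceil z\rceil,0\}$ steps. -/

import Mathlib

open scoped ENNReal NNReal

/-! ### Elementary random choices -/

/-- A coin that shows `true` with probability `q` (with `q` truncated to `[0, 1]`). -/
noncomputable def coin (q : ℝ) : PMF Bool :=
  PMF.ofFintype (fun b => cond b ((min 1 q.toNNReal : ℝ≥0) : ℝ≥0∞)
      (1 - ((min 1 q.toNNReal : ℝ≥0) : ℝ≥0∞))) (by
    rw [Fintype.sum_bool]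
    exact add_tsub_cancel_of_le (ENNReal.coe_le_one_iff.2 (min_le_left _ _)))

/-- Choose `i` with probability `u i / ∑ k, u k`, for nonnegative weights `u`.
If all weights vanish, the choice is uniform. -/
noncomputable def sampleWeights {k : ℕ} [NeZero k] (u : Fin k → ℝ) : PMF (Fin k) :=
  open scoped Classical in
  if h : (∑' i, ENNReal.ofReal (u i)) ≠ 0 then
    PMF.normalize (fun i => ENNReal.ofReal (u i)) h (by
      rw [tsum_fintype]
      exact ENNReal.sum_ne_top.2 fun _ _ => ENNReal.ofReal_ne_top)
  else PMF.uniformOfFintype (Fin k)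

/-! ### The minimum enclosing ball problem -/

/-- The squared radius of the smallest ball centered at `x` that contains all the rows of `A`. -/
noncomputable def sqRadiusAt {n d : ℕ} (A : Fin n → EuclideanSpace ℝ (Fin d))
    (x : EuclideanSpace ℝ (Fin d)) : ℝ :=
  ⨆ i, ‖x - A i‖ ^ 2

/-- The squared radius `σ` of the minimum enclosing ball of the rows of `A`. -/
noncomputable def mebSqRadius {n d : ℕ} (A : Fin n → EuclideanSpace ℝ (Fin d)) : ℝ :=
  ⨅ x, sqRadiusAt A x

/-- `x` is an `ε`-approximate center: the squared radius at `x` is at most `σ + ε`. -/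
def IsApproxMEBCenter {n d : ℕ} (A : Fin n → EuclideanSpace ℝ (Fin d)) (ε : ℝ)
    (x : EuclideanSpace ℝ (Fin d)) : Prop :=
  sqRadiusAt A x ≤ mebSqRadius A + ε

/-! ### The sublinear primal-dual algorithm -/

/-- `clip z V = min {V, max {-V, z}}`. -/
noncomputable def clip (z V : ℝ) : ℝ := min V (max (-V) z)

/-- What the algorithm holds at the start of an iteration: the dual weights `w`, the sum `y` of the
rows used so far in primal updates, the number `updates` of these updates, the primal point `x`,
and the sum `total` of the primal points of the preceding iterations. -/
structure MEBState (n d : ℕ) where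
  w : Fin n → ℝ
  y : EuclideanSpace ℝ (Fin d)
  updates : ℕ
  x : EuclideanSpace ℝ (Fin d)
  total : EuclideanSpace ℝ (Fin d)

/-- The initial values. -/
def MEBState.init (n d : ℕ) : MEBState n d where
  w := fun _ => 1
  y := 0
  updates := 0
  x := 0
  total := 0

/-- The clipped estimate `v i` of `‖A i - x‖ ^ 2` from the coordinate `j`.
At `x = 0` the first summand is `0`. -/
noncomputable def mebEstimate {n d : ℕ} (A : Fin n → EuclideanSpace ℝ (Fin d)) (η : ℝ)
    (x : EuclideanSpace ℝ (Fin d)) (j : Fin d) (i : Fin n) : ℝ :=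
  clip (-2 * A i j * ‖x‖ ^ 2 / x j + ‖A i‖ ^ 2 + ‖x‖ ^ 2) (1 / η)

/-- One iteration. The row `i` is drawn with probability proportional to `w i`; with probability
`α` the primal point becomes the follow-the-leader point, the mean of all rows used so far in primal
updates, row `i` included; `j` is drawn with probability `x j ^ 2 / ‖x‖ ^ 2`, for the point `x` that
the iteration started with; and the weights get the multiplicative update. -/
noncomputable def mebStep {n d : ℕ} [NeZero n] [NeZero d]
    (A : Fin n → EuclideanSpace ℝ (Fin d)) (η α : ℝ) (S : MEBState n d) : PMF (MEBState n d) :=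
  (sampleWeights S.w).bind fun i =>
  (coin α).bind fun b =>
  (sampleWeights fun j => S.x j ^ 2).map fun j =>
    { w := fun r =>
        S.w r * (1 + η * mebEstimate A η S.x j r + η ^ 2 * mebEstimate A η S.x j r ^ 2)
      y := if b then S.y + A i else S.y
      updates := if b then S.updates + 1 else S.updates
      x := if b then ((S.updates + 1 : ℕ) : ℝ)⁻¹ • (S.y + A i) else S.x
      total := S.total + S.x }

/-- The distribution of the state after `t` iterations. -/
noncomputable def mebIterate {n d : ℕ} [NeZero n] [NeZero d]
    (A : Fin n → EuclideanSpace ℝ (Fin d)) (η α : ℝ) : ℕ → PMF (MEBState n d)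
  | 0 => PMF.pure (MEBState.init n d)
  | t + 1 => (mebIterate A η α t).bind (mebStep A η α)

/-- The number of iterations, `T = ⌈c ε⁻² log n⌉`. -/
noncomputable def mebIterations (c : ℝ) (n : ℕ) (ε : ℝ) : ℕ := ⌈c * Real.log n / ε ^ 2⌉₊

/-- `η = √(log n / T)`. -/
noncomputable def mebEta (n T : ℕ) : ℝ := Real.sqrt (Real.log n / T)

/-- `α = log T / √(T log n)`. -/
noncomputable def mebAlpha (n T : ℕ) : ℝ := Real.log T / Real.sqrt (T * Real.log n)

/-- The distribution of the returned point, the mean of the primal points of the `T`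
iterations. -/
noncomputable def mebOutput {n d : ℕ} [NeZero n] [NeZero d] (c : ℝ)
    (A : Fin n → EuclideanSpace ℝ (Fin d)) (ε : ℝ) : PMF (EuclideanSpace ℝ (Fin d)) :=
  let T := mebIterations c n ε
  (mebIterate A (mebEta n T) (mebAlpha n T) T).map fun S => (T : ℝ)⁻¹ • S.total

/-! ### A unit-cost random access machine over the reals

A program is a finite piece of structured code for a random access machine with integer registers,
real registers and arrays of reals. The input is read only; one entry of the matrix, or the norm of
one row, is read in one step. The only source of randomness is a coin whose bias stands in a
register. Every operation takes one step, except that rounding a real up to an integer takes as many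
steps as counting up to the result. The loops are bounded, so every program halts. -/

/-- The input of the problem. Indices out of range read as `0`. -/
structure RAMInput where
  rows : ℕ
  cols : ℕ
  eps : ℝ
  entry : ℕ → ℕ → ℝ
  rowNorm : ℕ → ℝ

/-- The contents of the machine: integer registers, real registers, arrays. -/
structure RAMStore where
  int : ℕ → ℕ
  real : ℕ → ℝ
  arr : ℕ → ℕ → ℝ

/-- The arithmetic operations on reals. -/
inductive RealOp
  | add | sub | mul | div

/-- The value of an arithmetic operation. -/
noncomputable def RealOp.eval : RealOp → ℝ → ℝ → ℝ
  | add, a, b => a + b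
  | sub, a, b => a - b
  | mul, a, b => a * b
  | div, a, b => a / b

/-- Programs. The natural numbers that name registers and arrays are fixed in the code. -/
inductive RAMProgram
  /-- Put a constant, the number of rows, the number of columns into the integer register `r`. -/
  | intConst (r k : ℕ)
  | intRows (r : ℕ)
  | intCols (r : ℕ)
  /-- Put the sum, the truncated difference of the integer registers `a`, `b` into `r`. -/
  | intAdd (r a b : ℕ)
  | intSub (r a b : ℕ)
  /-- Round the real register `a` up into the integer register `r`. -/
  | intCeil (r a : ℕ)
  /-- Put a rational constant, the input `ε`, the value of the integer register `a`
  into the real register `r`. -/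
  | realConst (r : ℕ) (q : ℚ)
  | realEps (r : ℕ)
  | realOfInt (r a : ℕ)
  /-- Real arithmetic, square root, logarithm. -/
  | realOp (op : RealOp) (r a b : ℕ)
  | realSqrt (r a : ℕ)
  | realLog (r a : ℕ)
  /-- Read the matrix entry, the norm of the row, whose indices stand in integer registers. -/
  | readEntry (r i j : ℕ)
  | readNorm (r i : ℕ)
  /-- Read from, write to the array `s` at the index that stands in the integer register `i`. -/
  | load (r s i : ℕ)
  | store (s i a : ℕ)
  /-- Control: sequence, comparison of integers, comparison of reals, coin with the bias in the
  real register `a`, repetition as often as the integer register `a` says on entry. -/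
  | skip
  | seq (P Q : RAMProgram)
  | ifIntLt (a b : ℕ) (P Q : RAMProgram)
  | ifRealLt (a b : ℕ) (P Q : RAMProgram)
  | flip (a : ℕ) (P Q : RAMProgram)
  | loop (a : ℕ) (P : RAMProgram)

namespace RAMStore

/-- The store with all registers and arrays zero. -/
def init : RAMStore := ⟨fun _ => 0, fun _ => 0, fun _ _ => 0⟩

/-- Write an integer register. -/
def setInt (s : RAMStore) (r k : ℕ) : RAMStore := { s with int := Function.update s.int r k }

/-- Write a real register. -/
noncomputable def setReal (s : RAMStore) (r : ℕ) (z : ℝ) : RAMStore :=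
  { s with real := Function.update s.real r z }

/-- Write an array cell. -/
noncomputable def setArr (s : RAMStore) (a i : ℕ) (z : ℝ) : RAMStore :=
  { s with arr := Function.update s.arr a (Function.update (s.arr a) i z) }

end RAMStore

namespace RAMProgram

/-- Charge `k` further steps. -/
noncomputable def charge (k : ℕ) (p : PMF (RAMStore × ℕ)) : PMF (RAMStore × ℕ) :=
  p.map fun o => (o.1, o.2 + k)

/-- First `p`, then `f`; the step counts add up. -/
noncomputable def chain (p : PMF (RAMStore × ℕ)) (f : RAMStore → PMF (RAMStore × ℕ)) :
    PMF (RAMStore × ℕ) :=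
  p.bind fun o => charge o.2 (f o.1)

/-- Repeat `f`; each round costs one step on top of `f`. -/
noncomputable def rounds (f : RAMStore → PMF (RAMStore × ℕ)) :
    ℕ → RAMStore → PMF (RAMStore × ℕ)
  | 0, s => PMF.pure (s, 0)
  | k + 1, s => charge 1 (chain (f s) (rounds f k))

/-- The joint distribution of the final store and of the number of steps. -/
noncomputable def exec (I : RAMInput) : RAMProgram → RAMStore → PMF (RAMStore × ℕ)
  | intConst r k, s => PMF.pure (s.setInt r k, 1)
  | intRows r, s => PMF.pure (s.setInt r I.rows, 1)
  | intCols r, s => PMF.pure (s.setInt r I.cols, 1)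
  | intAdd r a b, s => PMF.pure (s.setInt r (s.int a + s.int b), 1)
  | intSub r a b, s => PMF.pure (s.setInt r (s.int a - s.int b), 1)
  | intCeil r a, s => PMF.pure (s.setInt r ⌈s.real a⌉₊, 1 + ⌈s.real a⌉₊)
  | realConst r q, s => PMF.pure (s.setReal r q, 1)
  | realEps r, s => PMF.pure (s.setReal r I.eps, 1)
  | realOfInt r a, s => PMF.pure (s.setReal r (s.int a), 1)
  | realOp op r a b, s => PMF.pure (s.setReal r (op.eval (s.real a) (s.real b)), 1)
  | realSqrt r a, s => PMF.pure (s.setReal r (Real.sqrt (s.real a)), 1)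
  | realLog r a, s => PMF.pure (s.setReal r (Real.log (s.real a)), 1)
  | readEntry r i j, s => PMF.pure (s.setReal r (I.entry (s.int i) (s.int j)), 1)
  | readNorm r i, s => PMF.pure (s.setReal r (I.rowNorm (s.int i)), 1)
  | load r a i, s => PMF.pure (s.setReal r (s.arr a (s.int i)), 1)
  | store a i b, s => PMF.pure (s.setArr a (s.int i) (s.real b), 1)
  | skip, s => PMF.pure (s, 1)
  | seq P Q, s => chain (exec I P s) (exec I Q)
  | ifIntLt a b P Q, s =>
      charge 1 (if s.int a < s.int b then exec I P s else exec I Q s)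
  | ifRealLt a b P Q, s =>
      open scoped Classical in
      charge 1 (if s.real a < s.real b then exec I P s else exec I Q s)
  | flip a P Q, s => charge 1 ((coin (s.real a)).bind fun h => cond h (exec I P s) (exec I Q s))
  | loop a P, s => charge 1 (rounds (exec I P) (s.int a) s)

/-- The distribution of the output vector, the first `d` cells of the array `0` at the end of the
run from the zero store. -/
noncomputable def output (P : RAMProgram) (I : RAMInput) (d : ℕ) :
    PMF (EuclideanSpace ℝ (Fin d)) :=
  (exec I P RAMStore.init).map fun o => WithLp.toLp 2 fun j : Fin d => o.1.arr 0 j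

/-- The expected number of steps of the run from the zero store. -/
noncomputable def expectedTime (P : RAMProgram) (I : RAMInput) : ℝ≥0∞ :=
  ∑' o : RAMStore × ℕ, exec I P RAMStore.init o * (o.2 : ℝ≥0∞)

end RAMProgram

/-- The input for the rows `A` and the accuracy `ε`, with the norms of the rows known. -/
noncomputable def mebInput {n d : ℕ} (A : Fin n → EuclideanSpace ℝ (Fin d)) (ε : ℝ) : RAMInput where
  rows := n
  cols := d
  eps := ε
  entry := fun i j => if h : i < n ∧ j < d then A ⟨i, h.1⟩ ⟨j, h.2⟩ else 0
  rowNorm := fun i => if h : i < n then ‖A ⟨i, h⟩‖ else 0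

/-! The proof has two independent halves: `program` realizes the algorithm within the claimed
expected time, and the returned point is good with probability at least one half.

Program. A simulation `Sim` is one inequality: for every price `c` per step and every test function,
the expected test value plus `c` times the number of steps is at most its counterpart for the target
distribution plus `c` times the cost bound. It composes under sequencing, branching and loops. At `c
= 0` it bounds the output distribution pointwise by the target, which forces equality; at zero test
function and `c = 1` it bounds the expected time. Two devices keep the time low. A column is drawn
by descending a binary tree of partial sums of squared coordinates, in `O(log d)` steps. The tree,
the point and the running total are touched only when the primal point changes: the total is stored
lazily, with a counter of pending copies of the current point. Hence the `O(d)` work is paid with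
probability `α` per iteration, and `T α` is of order `1 / ε` up to logarithms (`sim_iteration`,
`sim_program`, `runningTime_le`).

Success. Write `R(x)` for `sqRadiusAt A x`, `W` for the sum of the weights, and fix a comparison
point `z`. No concentration inequality is used; one potential, `mebPotential`, controls everything
in expectation. Its ingredients are: `log W`, whose expected growth is at most `η E_p ‖x - A i‖ ^ 2
+ 32 η ^ 2` (`expect_log_weights_le`); `log mebPhi`, the logarithm of the sum over rows of
exponentiated distance over weight, growing by at most `32 η ^ 2 - η ‖x‖ ^ 2`
(`expect_log_mebPhi_le`); `η ‖total‖ ^ 2 / t`, growing by at most `η ‖x‖ ^ 2`; `η / α` times the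
follow-the-leader potential, growing in expectation by at most `η (R(z) - E_p ‖x - A i‖ ^ 2)`, the
coin cancelling `α`; and `- η t R(z)`. Everything but `64 η ^ 2` cancels
(`stepExpect_mebPotential_le`). The potential starts at `2 log n`, and at the end it dominates `η T
(R(x̄) - R(z))` up to `(η / α) 4 (1 + log T)` (`sqRadiusAt_le_mebPotential`), because the product of
`W` and `mebPhi` exceeds each exponentiated distance. So the expected excess of `R(x̄)` over the
optimum is at most `ε / 2` (`regret_le_half`), and Markov's inequality gives the probability `1 /
2`. For `ε ≥ 4` every point of the unit ball is an approximate center. -/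

open PMF

/-! ### Expectations of nonnegative functions -/

namespace PMF

variable {α β : Type*}

/-- The expectation of a nonnegative function. -/
noncomputable def mean (p : PMF α) (f : α → ℝ≥0∞) : ℝ≥0∞ := ∑' a, p a * f a

theorem mean_pure (a : α) (f : α → ℝ≥0∞) : (PMF.pure a).mean f = f a := by
  unfold mean
  rw [tsum_eq_single a]
  · simp
  · intro b hb
    simp [hb]

theorem mean_bind (p : PMF α) (q : α → PMF β) (f : β → ℝ≥0∞) :
    (p.bind q).mean f = p.mean fun a => (q a).mean f := by
  simp only [mean, PMF.bind_apply, ← ENNReal.tsum_mul_right, ← ENNReal.tsum_mul_left]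
  rw [ENNReal.tsum_comm]
  simp only [mul_assoc]

theorem mean_map (p : PMF α) (g : α → β) (f : β → ℝ≥0∞) :
    (p.map g).mean f = p.mean fun a => f (g a) := by
  rw [← PMF.bind_pure_comp, mean_bind]
  simp only [Function.comp_apply, mean_pure]

theorem mean_mono (p : PMF α) {f g : α → ℝ≥0∞} (h : ∀ a, f a ≤ g a) : p.mean f ≤ p.mean g :=
  ENNReal.tsum_le_tsum fun a => mul_le_mul_right (h a) _

theorem mean_add (p : PMF α) (f g : α → ℝ≥0∞) :
    p.mean (fun a => f a + g a) = p.mean f + p.mean g := by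
  simp only [mean, mul_add]
  exact ENNReal.tsum_add

theorem mean_const (p : PMF α) (b : ℝ≥0∞) : p.mean (fun _ => b) = b := by
  simp only [mean, ENNReal.tsum_mul_right, p.tsum_coe, one_mul]

theorem mean_indicator (p : PMF α) (s : Set α) :
    p.mean (s.indicator 1) = p.toOuterMeasure s := by
  rw [PMF.toOuterMeasure_apply]
  refine tsum_congr fun a => ?_
  by_cases h : a ∈ s <;> simp [h]

theorem mean_single [DecidableEq α] (p : PMF α) (a : α) :
    p.mean (fun b => if b = a then 1 else 0) = p a := by
  unfold mean
  rw [tsum_eq_single a]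
  · simp
  · intro b hb
    simp [hb]

theorem mean_fintype [Fintype α] (p : PMF α) (f : α → ℝ≥0∞) : p.mean f = ∑ a, p a * f a :=
  tsum_fintype _

theorem mean_bool (p : PMF Bool) (f : Bool → ℝ≥0∞) :
    p.mean f = p true * f true + p false * f false := by
  rw [mean_fintype, Fintype.sum_bool]

/-- A distribution that is pointwise below another one equals it. -/
theorem eq_of_le {p q : PMF α} (h : ∀ a, p a ≤ q a) : p = q := by
  refine PMF.ext fun a => le_antisymm (h a) ?_
  by_contra! hlt
  have := ENNReal.tsum_lt_tsum (by rw [p.tsum_coe]; exact ENNReal.one_ne_top) h hlt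
  rw [p.tsum_coe, q.tsum_coe] at this
  exact lt_irrefl _ this

end PMF

/-! ### Expected values and expected costs of programs -/

namespace RAMProgram

variable {β γ : Type*} {I : RAMInput}

/-- The expectation of `G` at the final store plus `c` times the number of steps. -/
noncomputable def wp (c : ℝ≥0∞) (I : RAMInput) (P : RAMProgram) (G : RAMStore → ℝ≥0∞)
    (s : RAMStore) : ℝ≥0∞ :=
  (exec I P s).mean fun o => G o.1 + o.2 * c

theorem mean_charge (k : ℕ) (p : PMF (RAMStore × ℕ)) (F : RAMStore × ℕ → ℝ≥0∞) :
    (charge k p).mean F = p.mean fun o => F (o.1, o.2 + k) := mean_map _ _ _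

theorem mean_charge_cost (c : ℝ≥0∞) (k : ℕ) (p : PMF (RAMStore × ℕ)) (G : RAMStore → ℝ≥0∞) :
    (charge k p).mean (fun o => G o.1 + o.2 * c) =
      p.mean (fun o => G o.1 + o.2 * c) + k * c := by
  rw [mean_charge]
  simp only [Nat.cast_add, add_mul, ← add_assoc]
  rw [mean_add, mean_const]

theorem mean_chain (c : ℝ≥0∞) (p : PMF (RAMStore × ℕ)) (f : RAMStore → PMF (RAMStore × ℕ))
    (G : RAMStore → ℝ≥0∞) :
    (chain p f).mean (fun o => G o.1 + o.2 * c) =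
      p.mean fun o => (f o.1).mean (fun o' => G o'.1 + o'.2 * c) + o.2 * c := by
  rw [chain, mean_bind]
  simp only [mean_charge_cost]

theorem wp_seq (c : ℝ≥0∞) (P Q : RAMProgram) (G : RAMStore → ℝ≥0∞) (s : RAMStore) :
    wp c I (seq P Q) G s = wp c I P (wp c I Q G) s := mean_chain _ _ _ _

theorem wp_ifIntLt (c : ℝ≥0∞) (a b : ℕ) (P Q : RAMProgram) (G : RAMStore → ℝ≥0∞)
    (s : RAMStore) :
    wp c I (ifIntLt a b P Q) G s =
      (if s.int a < s.int b then wp c I P G s else wp c I Q G s) + c := by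
  rw [wp, exec, mean_charge_cost, Nat.cast_one, one_mul]
  split_ifs <;> rfl

open scoped Classical in
theorem wp_ifRealLt (c : ℝ≥0∞) (a b : ℕ) (P Q : RAMProgram) (G : RAMStore → ℝ≥0∞)
    (s : RAMStore) :
    wp c I (ifRealLt a b P Q) G s =
      (if s.real a < s.real b then wp c I P G s else wp c I Q G s) + c := by
  rw [wp, exec, mean_charge_cost, Nat.cast_one, one_mul]
  split_ifs <;> rfl

theorem wp_flip (c : ℝ≥0∞) (a : ℕ) (P Q : RAMProgram) (G : RAMStore → ℝ≥0∞) (s : RAMStore) :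
    wp c I (flip a P Q) G s =
      ((coin (s.real a)).mean fun h => cond h (wp c I P G s) (wp c I Q G s)) + c := by
  rw [wp, exec, mean_charge_cost, Nat.cast_one, one_mul, mean_bind]
  congr 2
  funext h
  cases h <;> rfl

theorem mean_rounds (c : ℝ≥0∞) (P : RAMProgram) (G : RAMStore → ℝ≥0∞) (k : ℕ) (s : RAMStore) :
    (rounds (exec I P) k s).mean (fun o => G o.1 + o.2 * c) =
      (fun F s => wp c I P F s + c)^[k] G s := by
  induction k generalizing s with
  | zero => simp [rounds, mean_pure]
  | succ k ih =>
    rw [rounds, mean_charge_cost, mean_chain, Function.iterate_succ_apply', Nat.cast_one, one_mul]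
    simp only [ih]
    rfl

theorem wp_loop (c : ℝ≥0∞) (a : ℕ) (P : RAMProgram) (G : RAMStore → ℝ≥0∞) (s : RAMStore) :
    wp c I (loop a P) G s = (fun F s => wp c I P F s + c)^[s.int a] G s + c := by
  rw [wp, exec, mean_charge_cost, mean_rounds, Nat.cast_one, one_mul]

theorem wp_of_exec {P : RAMProgram} {s s' : RAMStore} {k : ℕ} (h : exec I P s = PMF.pure (s', k))
    (c : ℝ≥0∞) (G : RAMStore → ℝ≥0∞) : wp c I P G s = G s' + k * c := by
  rw [wp, h, mean_pure]

/-! ### The registers and arrays that a program writes -/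

/-- The integer registers that a program may write. -/
def intWrites : RAMProgram → List ℕ
  | intConst r _ | intRows r | intCols r | intAdd r _ _ | intSub r _ _ | intCeil r _ => [r]
  | seq P Q | ifIntLt _ _ P Q | ifRealLt _ _ P Q | flip _ P Q => P.intWrites ++ Q.intWrites
  | loop _ P => P.intWrites
  | _ => []

/-- The real registers that a program may write. -/
def realWrites : RAMProgram → List ℕ
  | realConst r _ | realEps r | realOfInt r _ | realOp _ r _ _ | realSqrt r _ | realLog r _
  | readEntry r _ _ | readNorm r _ | load r _ _ => [r]
  | seq P Q | ifIntLt _ _ P Q | ifRealLt _ _ P Q | flip _ P Q => P.realWrites ++ Q.realWrites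
  | loop _ P => P.realWrites
  | _ => []

/-- The arrays that a program may write. -/
def arrWrites : RAMProgram → List ℕ
  | store a _ _ => [a]
  | seq P Q | ifIntLt _ _ P Q | ifRealLt _ _ P Q | flip _ P Q => P.arrWrites ++ Q.arrWrites
  | loop _ P => P.arrWrites
  | _ => []

/-- The stores agree except in the listed places. -/
structure Agree (li lr la : List ℕ) (s s' : RAMStore) : Prop where
  int : ∀ r, r ∉ li → s'.int r = s.int r
  real : ∀ r, r ∉ lr → s'.real r = s.real r
  arr : ∀ r, r ∉ la → s'.arr r = s.arr r

theorem Agree.refl (li lr la : List ℕ) (s : RAMStore) : Agree li lr la s s :=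
  ⟨fun _ _ => rfl, fun _ _ => rfl, fun _ _ => rfl⟩

theorem Agree.trans {li lr la : List ℕ} {s s' s'' : RAMStore} (h : Agree li lr la s s')
    (h' : Agree li lr la s' s'') : Agree li lr la s s'' :=
  ⟨fun r hr => (h'.int r hr).trans (h.int r hr), fun r hr => (h'.real r hr).trans (h.real r hr),
    fun r hr => (h'.arr r hr).trans (h.arr r hr)⟩

theorem Agree.mono {li lr la li' lr' la' : List ℕ} {s s' : RAMStore} (h : Agree li lr la s s')
    (hi : li ⊆ li') (hr : lr ⊆ lr') (ha : la ⊆ la') : Agree li' lr' la' s s' :=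
  ⟨fun r h' => h.int r fun h'' => h' (hi h''), fun r h' => h.real r fun h'' => h' (hr h''),
    fun r h' => h.arr r fun h'' => h' (ha h'')⟩

theorem agree_setInt (s : RAMStore) (r k : ℕ) (lr la : List ℕ) :
    Agree [r] lr la s (s.setInt r k) := by
  refine ⟨fun r' h => ?_, fun _ _ => rfl, fun _ _ => rfl⟩
  rw [List.mem_singleton] at h
  simp [RAMStore.setInt, h]

theorem agree_setReal (s : RAMStore) (r : ℕ) (z : ℝ) (li la : List ℕ) :
    Agree li [r] la s (s.setReal r z) := by
  refine ⟨fun _ _ => rfl, fun r' h => ?_, fun _ _ => rfl⟩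
  rw [List.mem_singleton] at h
  simp [RAMStore.setReal, h]

theorem agree_setArr (s : RAMStore) (a i : ℕ) (z : ℝ) (li lr : List ℕ) :
    Agree li lr [a] s (s.setArr a i z) := by
  refine ⟨fun _ _ => rfl, fun _ _ => rfl, fun r' h => ?_⟩
  rw [List.mem_singleton] at h
  simp [RAMStore.setArr, h]

/-- The values of `G` matter only at stores that differ from the initial one in the places that the
program writes. -/
theorem wp_congr (c : ℝ≥0∞) (P : RAMProgram) {li lr la : List ℕ} (hi : P.intWrites ⊆ li)
    (hr : P.realWrites ⊆ lr) (ha : P.arrWrites ⊆ la) {G G' : RAMStore → ℝ≥0∞} {s : RAMStore}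
    (h : ∀ s', Agree li lr la s s' → G s' = G' s') : wp c I P G s = wp c I P G' s := by
  induction P generalizing G G' s with
  | seq P Q hP hQ =>
    simp only [intWrites, realWrites, arrWrites, List.append_subset] at hi hr ha
    rw [wp_seq, wp_seq]
    exact hP hi.1 hr.1 ha.1 fun s' h' => hQ hi.2 hr.2 ha.2 fun s'' h'' => h _ (h'.trans h'')
  | ifIntLt a b P Q hP hQ =>
    simp only [intWrites, realWrites, arrWrites, List.append_subset] at hi hr ha
    rw [wp_ifIntLt, wp_ifIntLt, hP hi.1 hr.1 ha.1 h, hQ hi.2 hr.2 ha.2 h]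
  | ifRealLt a b P Q hP hQ =>
    simp only [intWrites, realWrites, arrWrites, List.append_subset] at hi hr ha
    rw [wp_ifRealLt, wp_ifRealLt, hP hi.1 hr.1 ha.1 h, hQ hi.2 hr.2 ha.2 h]
  | flip a P Q hP hQ =>
    simp only [intWrites, realWrites, arrWrites, List.append_subset] at hi hr ha
    rw [wp_flip, wp_flip, hP hi.1 hr.1 ha.1 h, hQ hi.2 hr.2 ha.2 h]
  | loop a P hP =>
    rw [wp_loop, wp_loop]
    congr 1
    generalize s.int a = k
    induction k generalizing s with
    | zero => exact h _ (Agree.refl _ _ _ _)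
    | succ k ih =>
      rw [Function.iterate_succ_apply', Function.iterate_succ_apply']
      congr 1
      exact hP hi hr ha fun s' h' => ih fun s'' h'' => h _ (h'.trans h'')
  | skip =>
    rw [wp_of_exec rfl, wp_of_exec rfl, h _ (Agree.refl _ _ _ _)]
  | store a i b =>
    rw [wp_of_exec rfl, wp_of_exec rfl, h]
    exact (agree_setArr _ _ _ _ [] []).mono (by simp) (by simp) ha
  | _ =>
    rw [wp_of_exec rfl, wp_of_exec rfl, h]
    first
      | exact (agree_setInt _ _ _ [] []).mono hi (by simp) (by simp)
      | exact (agree_setReal _ _ _ [] []).mono (by simp) hr (by simp)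

/-! ### Simulation -/

/-- From the store `s`, the program `P` realizes the random choice `q`, up to the relation `R`
between the final store and the value chosen, in at most `N` steps in expectation. -/
def Sim (I : RAMInput) (P : RAMProgram) (s : RAMStore) (q : PMF β) (R : RAMStore → β → Prop)
    (N : ℝ≥0∞) : Prop :=
  ∀ (c : ℝ≥0∞) (G : RAMStore → ℝ≥0∞) (H : β → ℝ≥0∞),
    (∀ s' b, R s' b → G s' ≤ H b) → wp c I P G s ≤ q.mean H + N * c

/-- From the store `s`, the program `P` surely reaches a store with the property `R`, in at most
`N` steps in expectation. -/
def Reach (I : RAMInput) (P : RAMProgram) (s : RAMStore) (R : RAMStore → Prop) (N : ℝ≥0∞) : Prop :=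
  ∀ (c : ℝ≥0∞) (G : RAMStore → ℝ≥0∞) (M : ℝ≥0∞),
    (∀ s', R s' → G s' ≤ M) → wp c I P G s ≤ M + N * c

theorem Sim.mono {P : RAMProgram} {s : RAMStore} {q : PMF β} {R R' : RAMStore → β → Prop}
    {N N' : ℝ≥0∞} (h : Sim I P s q R N) (hR : ∀ s' b, R s' b → R' s' b) (hN : N ≤ N') :
    Sim I P s q R' N' := fun c G H hG =>
  (h c G H fun s' b hb => hG s' b (hR s' b hb)).trans
    (add_le_add_right (mul_le_mul_left hN c) _)

theorem Reach.mono {P : RAMProgram} {s : RAMStore} {R R' : RAMStore → Prop}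
    {N N' : ℝ≥0∞} (h : Reach I P s R N) (hR : ∀ s', R s' → R' s') (hN : N ≤ N') :
    Reach I P s R' N' := fun c G M hG =>
  (h c G M fun s' hb => hG s' (hR s' hb)).trans
    (add_le_add_right (mul_le_mul_left hN c) _)

/-- Stores that differ outside the written places are never reached, so the test function may be set
to zero there without changing its expectation. -/
theorem Sim.frame {P : RAMProgram} {s : RAMStore} {q : PMF β} {R : RAMStore → β → Prop}
    {N : ℝ≥0∞} (h : Sim I P s q R N) :
    Sim I P s q (fun s' b => R s' b ∧ Agree P.intWrites P.realWrites P.arrWrites s s') N := by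
  classical
  intro c G H hG
  rw [wp_congr (G' := fun s' => if Agree P.intWrites P.realWrites P.arrWrites s s' then G s' else 0)
    c P (List.Subset.refl _) (List.Subset.refl _)
      (List.Subset.refl _) fun s' h' => (if_pos h').symm]
  refine h c _ H fun s' b hb => ?_
  split_ifs with h'
  · exact hG s' b ⟨hb, h'⟩
  · exact zero_le

theorem Reach.frame {P : RAMProgram} {s : RAMStore} {R : RAMStore → Prop}
    {N : ℝ≥0∞} (h : Reach I P s R N) :
    Reach I P s (fun s' => R s' ∧ Agree P.intWrites P.realWrites P.arrWrites s s') N := by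
  classical
  intro c G M hG
  rw [wp_congr (G' := fun s' => if Agree P.intWrites P.realWrites P.arrWrites s s' then G s' else 0)
    c P (List.Subset.refl _) (List.Subset.refl _)
      (List.Subset.refl _) fun s' h' => (if_pos h').symm]
  refine h c _ M fun s' hb => ?_
  split_ifs with h'
  · exact hG s' ⟨hb, h'⟩
  · exact zero_le

theorem Sim.seq {P Q : RAMProgram} {s : RAMStore} {q : PMF β} {h : β → PMF γ}
    {R : RAMStore → β → Prop} {R' : RAMStore → γ → Prop} {N N' : ℝ≥0∞} (hP : Sim I P s q R N)
    (hQ : ∀ s' b, R s' b → Sim I Q s' (h b) R' N') :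
    Sim I (seq P Q) s (q.bind h) R' (N + N') := by
  intro c G H hG
  rw [wp_seq, mean_bind]
  refine (hP c _ (fun b => (h b).mean H + N' * c) fun s' b hb => hQ s' b hb c G H hG).trans ?_
  rw [mean_add, mean_const, add_assoc, add_mul, add_comm (N' * c)]

theorem Reach.seq_sim {P Q : RAMProgram} {s : RAMStore} {q : PMF β}
    {R : RAMStore → Prop} {R' : RAMStore → β → Prop} {N N' : ℝ≥0∞} (hP : Reach I P s R N)
    (hQ : ∀ s', R s' → Sim I Q s' q R' N') :
    Sim I (seq P Q) s q R' (N + N') := by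
  intro c G H hG
  rw [wp_seq]
  refine (hP c _ (q.mean H + N' * c) fun s' hb => hQ s' hb c G H hG).trans ?_
  rw [add_assoc, add_mul, add_comm (N' * c)]

theorem Reach.seq {P Q : RAMProgram} {s : RAMStore}
    {R : RAMStore → Prop} {R' : RAMStore → Prop} {N N' : ℝ≥0∞} (hP : Reach I P s R N)
    (hQ : ∀ s', R s' → Reach I Q s' R' N') :
    Reach I (seq P Q) s R' (N + N') := by
  intro c G M hG
  rw [wp_seq]
  refine (hP c _ (M + N' * c) fun s' hb => hQ s' hb c G M hG).trans ?_
  rw [add_assoc, add_mul, add_comm (N' * c)]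

theorem Sim.seq_reach {P Q : RAMProgram} {s : RAMStore} {q : PMF β}
    {R : RAMStore → β → Prop} {R' : RAMStore → β → Prop} {N N' : ℝ≥0∞} (hP : Sim I P s q R N)
    (hQ : ∀ s' b, R s' b → Reach I Q s' (fun s'' => R' s'' b) N') :
    Sim I (RAMProgram.seq P Q) s q R' (N + N') := by
  intro c G H hG
  rw [wp_seq]
  refine (hP c _ (fun b => H b + N' * c) fun s' b hb =>
    hQ s' b hb c G (H b) fun s'' h'' => hG s'' b h'').trans ?_
  rw [mean_add, mean_const, add_assoc, add_mul, add_comm (N' * c)]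

/-- The branch costs are weighted by the probabilities of the coin instead of being replaced by
their maximum; this is what makes an `O(d)` branch cost only `α d` on average. -/
theorem Sim.flip {P Q : RAMProgram} {s : RAMStore} {a : ℕ} {h : Bool → PMF β}
    {R : RAMStore → β → Prop} {N N' : ℝ≥0∞} (hP : Sim I P s (h true) R N)
    (hQ : Sim I Q s (h false) R N') :
    Sim I (flip a P Q) s ((coin (s.real a)).bind h) R
      (coin (s.real a) true * N + coin (s.real a) false * N' + 1) := by
  intro c G H hG
  rw [wp_flip, mean_bind, mean_bool, mean_bool]
  refine (add_le_add_left (add_le_add (mul_le_mul_right (hP c G H hG) _)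
    (mul_le_mul_right (hQ c G H hG) _)) _).trans (le_of_eq ?_)
  ring

/-- Invariants of loops that realize `N` successive random choices. -/
theorem Sim.loop {P : RAMProgram} {s : RAMStore} {a N : ℕ} {q : ℕ → PMF β} {h : ℕ → β → PMF β}
    {R : ℕ → RAMStore → β → Prop} {K : ℝ≥0∞} {b₀ : β} (ha : s.int a = N)
    (h0 : R 0 s b₀) (hq0 : q 0 = PMF.pure b₀) (hq : ∀ i < N, q (i + 1) = (q i).bind (h i))
    (hP : ∀ i < N, ∀ s' b, R i s' b → Sim I P s' (h i b) (R (i + 1)) K) :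
    Sim I (loop a P) s (q N) (R N) (N * (K + 1) + 1) := by
  intro c G H hG
  rw [wp_loop, ha, add_mul, one_mul, ← add_assoc]
  refine add_le_add_left ?_ _
  clear ha
  induction N generalizing G H with
  | zero => simpa [hq0, mean_pure] using hG s b₀ h0
  | succ N ih =>
    -- The innermost application of the iterate is the last round, so the induction peels rounds off
    -- at the end, matching `q (N + 1) = (q N).bind (h N)`.
    rw [Function.iterate_succ_apply, hq N (Nat.lt_succ_self N), mean_bind]
    refine (ih (fun i hi => hq i (hi.trans (Nat.lt_succ_self N)))
      (fun i hi => hP i (hi.trans (Nat.lt_succ_self N))) _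
      (fun b => (h N b).mean H + (K + 1) * c) fun s' b hb => ?_).trans ?_
    · refine (add_le_add_left (hP N (Nat.lt_succ_self N) s' b hb c G H hG) c).trans (le_of_eq ?_)
      ring
    · rw [mean_add, mean_const]
      push_cast
      exact le_of_eq (by ring)

theorem Reach.sim {P : RAMProgram} {s : RAMStore} {R : RAMStore → Prop} {N : ℝ≥0∞} {b : β}
    {R' : RAMStore → β → Prop} (h : Reach I P s R N) (hR : ∀ s', R s' → R' s' b) :
    Sim I P s (PMF.pure b) R' N := by
  intro c G H hG
  rw [mean_pure]
  exact h c G _ fun s' h' => hG s' b (hR s' h')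

theorem Sim.reach {P : RAMProgram} {s : RAMStore} {R : RAMStore → Prop} {N : ℝ≥0∞} {q : PMF β}
    (h : Sim I P s q (fun s' _ => R s') N) : Reach I P s R N := by
  intro c G M hG
  refine (h c G (fun _ => M) fun s' _ h' => hG s' h').trans ?_
  rw [mean_const]

theorem Reach.loop {P : RAMProgram} {s : RAMStore} {a N : ℕ}
    {R : ℕ → RAMStore → Prop} {K : ℝ≥0∞} (ha : s.int a = N) (h0 : R 0 s)
    (hP : ∀ i < N, ∀ s', R i s' → Reach I P s' (R (i + 1)) K) :
    Reach I (loop a P) s (R N) (N * (K + 1) + 1) :=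
  (Sim.loop (q := fun _ => PMF.pure ()) (h := fun _ _ => PMF.pure ()) (b₀ := ())
    (R := fun i s _ => R i s) ha h0 rfl (fun _ _ => by rw [PMF.pure_bind])
    fun i hi s' _ hs => (hP i hi s' hs).sim fun _ h => h).reach

theorem Reach.of_exec {P : RAMProgram} {s s' : RAMStore} {k : ℕ} {R : RAMStore → Prop}
    (h : exec I P s = PMF.pure (s', k)) (hR : R s') : Reach I P s R k := by
  intro c G M hG
  rw [wp_of_exec h]
  exact add_le_add_left (hG _ hR) _

theorem Reach.seq_exec {P Q : RAMProgram} {s s' : RAMStore} {k : ℕ} {R : RAMStore → Prop}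
    {N : ℝ≥0∞} (h : exec I P s = PMF.pure (s', k)) (hQ : Reach I Q s' R N) :
    Reach I (RAMProgram.seq P Q) s R (k + N) :=
  (Reach.of_exec (R := fun t => t = s') h rfl).seq fun _ ht => ht ▸ hQ

theorem Sim.seq_exec {P Q : RAMProgram} {s s' : RAMStore} {k : ℕ} {q : PMF β}
    {R : RAMStore → β → Prop}
    {N : ℝ≥0∞} (h : exec I P s = PMF.pure (s', k)) (hQ : Sim I Q s' q R N) :
    Sim I (RAMProgram.seq P Q) s q R (k + N) :=
  (Reach.of_exec (R := fun t => t = s') h rfl).seq_sim fun _ ht => ht ▸ hQ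

theorem Reach.ifIntLt {P Q : RAMProgram} {s : RAMStore} {a b : ℕ} {R : RAMStore → Prop}
    {N : ℝ≥0∞} (hP : s.int a < s.int b → Reach I P s R N)
    (hQ : s.int b ≤ s.int a → Reach I Q s R N) : Reach I (ifIntLt a b P Q) s R (N + 1) := by
  intro c G M hG
  rw [wp_ifIntLt, add_mul, one_mul, ← add_assoc]
  refine add_le_add_left ?_ _
  split_ifs with h
  · exact hP h c G M hG
  · exact hQ (not_lt.1 h) c G M hG

theorem Reach.ifRealLt {P Q : RAMProgram} {s : RAMStore} {a b : ℕ} {R : RAMStore → Prop}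
    {N : ℝ≥0∞} (hP : s.real a < s.real b → Reach I P s R N)
    (hQ : s.real b ≤ s.real a → Reach I Q s R N) : Reach I (ifRealLt a b P Q) s R (N + 1) := by
  intro c G M hG
  rw [wp_ifRealLt, add_mul, one_mul, ← add_assoc]
  refine add_le_add_left ?_ _
  split_ifs with h
  · exact hP h c G M hG
  · exact hQ (not_lt.1 h) c G M hG

/-- Programs one after the other. -/
def block : List RAMProgram → RAMProgram
  | [] => skip
  | P :: l => seq P (block l)

/-- A program that realizes the random choice `q` has the output distribution and the running time
that the relation prescribes. -/
theorem Sim.output_eq {P : RAMProgram} {d : ℕ} {q : PMF (EuclideanSpace ℝ (Fin d))} {N : ℝ≥0∞}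
    (h : Sim I P RAMStore.init q (fun s x => ∀ j : Fin d, s.arr 0 j = x j) N) :
    P.output I d = q := by
  classical
  refine PMF.eq_of_le fun x => ?_
  -- At price zero, the indicator of the output `x` yields the pointwise bound; total mass one turns
  -- it into equality.
  have := h 0 (fun s => if (WithLp.toLp 2 fun j : Fin d => s.arr 0 j) = x then 1 else 0)
    (fun y => if y = x then 1 else 0) fun s y hy => by
      have : (WithLp.toLp 2 fun j : Fin d => s.arr 0 j) = y := by
        ext j
        exact hy j
      rw [this]
  rw [mul_zero, add_zero, mean_single, wp] at this
  rw [← mean_single (P.output I d) x, output, mean_map]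
  simpa using this

theorem Sim.expectedTime_le {P : RAMProgram} {q : PMF β} {R : RAMStore → β → Prop} {N : ℝ≥0∞}
    (h : Sim I P RAMStore.init q R N) : P.expectedTime I ≤ N := by
  have := h 1 (fun _ => 0) (fun _ => 0) fun _ _ _ => le_rfl
  rw [mean_const, zero_add, mul_one, wp] at this
  simpa [mean, expectedTime] using this

end RAMProgram

/-! ### The elementary random choices -/

theorem coin_true {q : ℝ} (h1 : q ≤ 1) : coin q true = ENNReal.ofReal q := by
  rw [coin, PMF.ofFintype_apply, cond_true, min_eq_right (Real.toNNReal_le_one.2 h1)]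
  rfl

theorem coin_false {q : ℝ} (h1 : q ≤ 1) (h0 : 0 ≤ q) :
    coin q false = ENNReal.ofReal (1 - q) := by
  rw [coin, PMF.ofFintype_apply, cond_false, min_eq_right (Real.toNNReal_le_one.2 h1),
    ENNReal.ofReal_sub _ h0, ENNReal.ofReal_one]
  rfl

theorem sampleWeights_apply {k : ℕ} [NeZero k] {u : Fin k → ℝ} (hu : ∀ i, 0 ≤ u i)
    (hs : 0 < ∑ i, u i) (i : Fin k) : sampleWeights u i = ENNReal.ofReal (u i / ∑ j, u j) := by
  have hsum : ∑' i, ENNReal.ofReal (u i) = ENNReal.ofReal (∑ i, u i) := by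
    rw [tsum_fintype, ENNReal.ofReal_sum_of_nonneg fun i _ => hu i]
  have hne : ∑' i, ENNReal.ofReal (u i) ≠ 0 := by
    rw [hsum]
    exact (ENNReal.ofReal_pos.2 hs).ne'
  rw [sampleWeights, dif_pos hne, PMF.normalize_apply, hsum, ENNReal.ofReal_div_of_pos hs,
    div_eq_mul_inv]

namespace PMF

theorem ext_mean {α : Type*} {p q : PMF α} (h : ∀ f, p.mean f = q.mean f) : p = q := by
  classical
  refine PMF.ext fun a => ?_
  rw [← mean_single p a, h, mean_single]

theorem mean_coin {q : ℝ} (h1 : q ≤ 1) (h0 : 0 ≤ q) (f : Bool → ℝ≥0∞) :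
    (coin q).mean f = ENNReal.ofReal q * f true + ENNReal.ofReal (1 - q) * f false := by
  rw [mean_bool, coin_true h1, coin_false h1 h0]

end PMF

/-- Go through `0, …, k - 1` and replace the choice made so far by `i` with probability
`u i / ∑ r ≤ i, u r`. -/
noncomputable def reservoir (u : ℕ → ℝ) : ℕ → PMF ℕ
  | 0 => PMF.pure 0
  | k + 1 => (reservoir u k).bind fun i =>
      (coin (u k / ∑ r ∈ Finset.range (k + 1), u r)).map fun b => cond b k i

/-- An earlier choice `r` survives the new coin with probability `W / (W + u (k + 1))`, where `W` is
the old partial sum, and this factor turns `u r / W` into `u r / (W + u (k + 1))`. -/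
theorem mean_reservoir {u : ℕ → ℝ} (k : ℕ) (hu : ∀ r ≤ k, 0 < u r) (H : ℕ → ℝ≥0∞) :
    (reservoir u (k + 1)).mean H =
      ∑ r ∈ Finset.range (k + 1), ENNReal.ofReal (u r / ∑ r ∈ Finset.range (k + 1), u r) * H r := by
  induction k generalizing H with
  | zero =>
    -- The first coin is certain, so the arbitrary starting value of `reservoir` is overwritten.
    have h : u 0 / u 0 = 1 := div_self (hu 0 le_rfl).ne'
    simp only [reservoir, PMF.pure_bind, mean_map, zero_add, Finset.sum_range_one, h]
    rw [mean_coin le_rfl zero_le_one]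
    simp
  | succ k ih =>
    have hW : 0 < ∑ r ∈ Finset.range (k + 1), u r :=
      Finset.sum_pos (fun r hr => hu r (by have := Finset.mem_range.1 hr; omega)) (by simp)
    have hk := hu (k + 1) le_rfl
    rw [reservoir, mean_bind, ih fun r hr => hu r (by omega)]
    simp only [mean_map]
    rw [Finset.sum_range_succ u (k + 1), Finset.sum_range_succ _ (k + 1)]
    set W := ∑ r ∈ Finset.range (k + 1), u r
    have hp : 0 ≤ u (k + 1) / (W + u (k + 1)) := by positivity
    have hp1 : u (k + 1) / (W + u (k + 1)) ≤ 1 := by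
      rw [div_le_one (by positivity)]
      linarith
    have h1 : ∑ r ∈ Finset.range (k + 1), ENNReal.ofReal (u r / W) = 1 := by
      rw [← ENNReal.ofReal_sum_of_nonneg, ← Finset.sum_div, div_self hW.ne', ENNReal.ofReal_one]
      intro r hr
      exact div_nonneg (hu r (by have := Finset.mem_range.1 hr; omega)).le hW.le
    simp only [mean_coin hp1 hp, cond_true, cond_false, mul_add, Finset.sum_add_distrib,
      ← Finset.sum_mul, h1, one_mul, ← mul_assoc]
    rw [add_comm]
    congr 1
    refine Finset.sum_congr rfl fun r hr => ?_
    have := (hu r (by have := Finset.mem_range.1 hr; omega)).le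
    rw [← ENNReal.ofReal_mul (div_nonneg this hW.le)]
    congr 2
    field_simp
    ring

theorem reservoir_eq {n : ℕ} [NeZero n] {u : ℕ → ℝ} (hu : ∀ r < n, 0 < u r) :
    reservoir u n = (sampleWeights fun i : Fin n => u i).map Fin.val := by
  refine ext_mean fun H => ?_
  obtain ⟨k, rfl⟩ := Nat.exists_eq_succ_of_ne_zero (NeZero.ne n)
  have hpos : 0 < ∑ i : Fin (k + 1), u i := Finset.sum_pos (fun i _ => hu i i.2) (by simp)
  change (reservoir u (k + 1)).mean H = _
  rw [mean_reservoir k (fun r hr => hu r (by omega)), mean_map, mean_fintype,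
    ← Fin.sum_univ_eq_sum_range (fun r => u r),
    ← Fin.sum_univ_eq_sum_range
      (fun r => ENNReal.ofReal (u r / ∑ i : Fin (k + 1), u i) * H r)]
  refine Finset.sum_congr rfl fun i _ => ?_
  rw [sampleWeights_apply (fun i => (hu i i.2).le) hpos]

/-- Walk down from the root of a heap-shaped binary tree with the node weights `t`, going to a child
with probability proportional to its weight. -/
noncomputable def heapWalk (t : ℕ → ℝ) : ℕ → PMF ℕ
  | 0 => PMF.pure 1
  | l + 1 => (heapWalk t l).bind fun v =>
      (coin (t (v + v) / t v)).map fun b => cond b (v + v) (v + v + 1)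

theorem sum_range_double {M : Type*} [AddCommMonoid M] (f : ℕ → M) (k : ℕ) :
    ∑ i ∈ Finset.range (k + k), f i = ∑ i ∈ Finset.range k, (f (i + i) + f (i + i + 1)) := by
  induction k with
  | zero => simp
  | succ k ih =>
    rw [show k + 1 + (k + 1) = k + k + 1 + 1 by ring, Finset.sum_range_succ, Finset.sum_range_succ,
      Finset.sum_range_succ, ih, add_assoc]

/-- Along a path the ratios of child weight to parent weight telescope to leaf weight over root
weight. The nodes of depth `l` are `2 ^ l, …, 2 ^ (l + 1) - 1`. -/
theorem mean_heapWalk {t : ℕ → ℝ} (l : ℕ) (h0 : ∀ v, 1 ≤ v → v < 2 ^ (l + 1) → 0 ≤ t v)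
    (h1 : 0 < t 1) (hadd : ∀ v, 1 ≤ v → v < 2 ^ l → t v = t (v + v) + t (v + v + 1))
    (H : ℕ → ℝ≥0∞) :
    (heapWalk t l).mean H =
      ∑ k ∈ Finset.range (2 ^ l), ENNReal.ofReal (t (2 ^ l + k) / t 1) * H (2 ^ l + k) := by
  induction l generalizing H with
  | zero => simp [heapWalk, mean_pure, div_self h1.ne']
  | succ l ih =>
    have hpow : 2 ^ (l + 1) = 2 ^ l + 2 ^ l := by ring
    have hpow' : 2 ^ (l + 1 + 1) = 2 ^ (l + 1) + 2 ^ (l + 1) := by ring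
    have hpos : 0 < 2 ^ l := by positivity
    rw [heapWalk, mean_bind, ih (fun v hv hv' => h0 v hv (by omega))
      (fun v hv hv' => hadd v hv (by omega)), hpow, sum_range_double]
    refine Finset.sum_congr rfl fun k hk => ?_
    have hk := Finset.mem_range.1 hk
    rw [mean_map, show 2 ^ l + 2 ^ l + (k + k) = 2 ^ l + k + (2 ^ l + k) by ring,
      show 2 ^ l + 2 ^ l + (k + k + 1) = 2 ^ l + k + (2 ^ l + k) + 1 by ring]
    have hv : 1 ≤ 2 ^ l + k := by omega
    have hv' : 2 ^ l + k < 2 ^ (l + 1) := by omega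
    set v := 2 ^ l + k
    have e := hadd v hv hv'
    have ha := h0 (v + v) (by omega) (by omega)
    have hb := h0 (v + v + 1) (by omega) (by omega)
    have hv0 := h0 v hv (by omega)
    rw [mean_coin (div_le_one_of_le₀ (by linarith) hv0) (by positivity), mul_add, ← mul_assoc,
      ← mul_assoc, ← ENNReal.ofReal_mul (by positivity), ← ENNReal.ofReal_mul (by positivity)]
    -- A node of weight zero has a meaningless quotient as bias, but it is reached with probability
    -- zero and its children also weigh zero.
    rcases hv0.eq_or_lt with hz | hz
    · have ha0 : t (v + v) = 0 := by linarith
      have hb0 : t (v + v + 1) = 0 := by linarith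
      simp [ha0, hb0, ← hz]
    · congr 3
      · field_simp
      · field_simp
        linarith

theorem heapWalk_eq {d l : ℕ} [NeZero d] {t : ℕ → ℝ} {u : Fin d → ℝ} (hu : ∀ j, 0 ≤ u j)
    (hpos : 0 < ∑ j, u j) (hd : d ≤ 2 ^ l)
    (hadd : ∀ v, 1 ≤ v → v < 2 ^ l → t v = t (v + v) + t (v + v + 1))
    (hleaf : ∀ j : Fin d, t (2 ^ l + j) = u j) (hz : ∀ k, d ≤ k → k < 2 ^ l → t (2 ^ l + k) = 0) :
    heapWalk t l = (sampleWeights u).map (fun j : Fin d => 2 ^ l + (j : ℕ)) := by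
  -- Each level of the tree has the same sum, so the root carries the sum of the leaves.
  have key : ∀ (f : ℕ → ℝ), (∀ v, 1 ≤ v → v < 2 ^ l → f v = f (v + v) + f (v + v + 1)) →
      f 1 = ∑ k ∈ Finset.range (2 ^ l), f (2 ^ l + k) := by
    intro f hf
    have : ∀ m ≤ l, f 1 = ∑ k ∈ Finset.range (2 ^ m), f (2 ^ m + k) := by
      intro m
      induction m with
      | zero => simp
      | succ m ih =>
        intro hm
        have hpow : 2 ^ (m + 1) = 2 ^ m + 2 ^ m := by ring
        have hle : 2 ^ (m + 1) ≤ 2 ^ l := Nat.pow_le_pow_right two_pos hm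
        rw [ih (by omega), hpow, sum_range_double]
        refine Finset.sum_congr rfl fun k hk => ?_
        have hk := Finset.mem_range.1 hk
        rw [hf (2 ^ m + k) (by have : 0 < 2 ^ m := by positivity
                               omega) (by omega)]
        congr 2 <;> ring
    exact this l le_rfl
  have hcut : ∀ {M : Type} [AddCommMonoid M] (g : ℕ → M), (∀ k, d ≤ k → k < 2 ^ l → g k = 0) →
      ∑ k ∈ Finset.range (2 ^ l), g k = ∑ j : Fin d, g j := by
    intro M _ g hg
    rw [Fin.sum_univ_eq_sum_range g]
    refine (Finset.sum_subset (by simpa using hd) fun k hk hk' => ?_).symm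
    exact hg k (by simpa using hk') (by simpa using hk)
  -- Nonnegativity climbs from the leaves; `m` bounds the height of the node `v` above the leaf
  -- level.
  have hnonneg : ∀ m v, 1 ≤ v → 2 ^ l ≤ v * 2 ^ m → v < 2 ^ (l + 1) → 0 ≤ t v := by
    intro m
    induction m with
    | zero =>
      intro v _ hv hv'
      obtain ⟨k, rfl⟩ := Nat.exists_eq_add_of_le (by simpa using hv : 2 ^ l ≤ v)
      rcases lt_or_ge k d with h | h
      · rw [hleaf ⟨k, h⟩]
        exact hu _
      · rw [hz k h (by rw [pow_succ] at hv'; omega)]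
    | succ m ih =>
      intro v h1 hv hv'
      rw [pow_succ] at hv'
      rcases lt_or_ge v (2 ^ l) with h | h
      · rw [hadd v h1 h]
        have e : v * 2 ^ (m + 1) = (v + v) * 2 ^ m := by ring
        have e' : (v + v) * 2 ^ m ≤ (v + v + 1) * 2 ^ m := 
          Nat.mul_le_mul_right _ (Nat.le_succ _)
        exact add_nonneg (ih _ (by omega) (by omega) (by rw [pow_succ]; omega))
          (ih _ (by omega) (by omega) (by rw [pow_succ]; omega))
      · exact ih v h1 (h.trans (Nat.le_mul_of_pos_right _ (by positivity)))
          (by rw [pow_succ]; omega)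
  have ht1 : t 1 = ∑ j, u j := by
    rw [key t hadd, hcut _ hz]
    exact Finset.sum_congr rfl fun j _ => hleaf j
  refine ext_mean fun H => ?_
  rw [mean_heapWalk l (fun v hv hv' => hnonneg l v hv (Nat.le_mul_of_pos_left _ hv) hv')
    (ht1 ▸ hpos) hadd, hcut _ fun k hk hk' => by simp [hz k hk hk'], mean_map, mean_fintype]
  refine Finset.sum_congr rfl fun j _ => ?_
  rw [sampleWeights_apply hu hpos, hleaf, ht1]

namespace RAMProgram

variable {β γ : Type*} {I : RAMInput}

/-- A test function on `γ` need not factor through `f`; the supremum of `G` over the stores related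
to a value is the least test function on `β` that does the job. -/
theorem Sim.of_map {P : RAMProgram} {s : RAMStore} {q : PMF β} {q' : PMF γ} {f : γ → β}
    {R : RAMStore → β → Prop} {R' : RAMStore → γ → Prop} {N : ℝ≥0∞} (h : Sim I P s q R N)
    (hq : q = q'.map f) (hR : ∀ s' b, R s' (f b) → R' s' b) : Sim I P s q' R' N := by
  intro c G H hG
  refine (h c G (fun b => ⨆ (s' : RAMStore) (_ : R s' b), G s') fun s' b hb =>
    le_iSup₂_of_le s' hb le_rfl).trans (add_le_add_left ?_ _)
  rw [hq, mean_map]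
  exact mean_mono _ fun b => iSup₂_le fun s' hs' => hG s' b (hR s' b hs')

/-- Serves the case of a zero primal point, where the drawn column has no influence and any
distribution is simulated by any choice. -/
theorem Reach.sim_of_forall {P : RAMProgram} {s : RAMStore} {R : RAMStore → Prop} {N : ℝ≥0∞}
    (q : PMF β) {R' : RAMStore → β → Prop} (h : Reach I P s R N)
    (hR : ∀ s', R s' → ∀ b, R' s' b) : Sim I P s q R' N := by
  intro c G H hG
  refine h c G _ fun s' hs' => ?_
  rw [← mean_const q (G s')]
  exact mean_mono _ fun b => hG s' b (hR s' hs' b)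

theorem Sim.to_reach {P : RAMProgram} {s : RAMStore} {q : PMF β} {R : RAMStore → β → Prop}
    {R' : RAMStore → Prop} {N : ℝ≥0∞}
    (h : Sim I P s q R N) (hR : ∀ s' b, R s' b → R' s') : Reach I P s R' N :=
  (h.mono (R' := fun s' _ => R' s') hR le_rfl).reach

end RAMProgram

/-! ### Rules for programs whose cost is bounded by a natural number -/

namespace RAMStore

variable (s : RAMStore) (r r' k i i' : ℕ) (z : ℝ)

@[simp] theorem int_setInt : (s.setInt r k).int r' = if r' = r then k else s.int r' :=
  Function.update_apply _ _ _ _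
@[simp] theorem real_setInt : (s.setInt r k).real = s.real := rfl
@[simp] theorem arr_setInt : (s.setInt r k).arr = s.arr := rfl
@[simp] theorem int_setReal : (s.setReal r z).int = s.int := rfl
@[simp] theorem real_setReal : (s.setReal r z).real r' = if r' = r then z else s.real r' :=
  Function.update_apply _ _ _ _
@[simp] theorem arr_setReal : (s.setReal r z).arr = s.arr := rfl
@[simp] theorem int_setArr : (s.setArr r i z).int = s.int := rfl
@[simp] theorem real_setArr : (s.setArr r i z).real = s.real := rfl
@[simp] theorem arr_setArr :
    (s.setArr r i z).arr r' i' = if r' = r then if i' = i then z else s.arr r i' else s.arr r' i' := by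
  simp only [setArr, Function.update_apply]
  split_ifs <;> simp_all

end RAMStore

namespace RAMProgram

variable {β γ : Type*} {I : RAMInput}

theorem Reach.step {P : RAMProgram} {l : List RAMProgram} {s s' : RAMStore} {R : RAMStore → Prop}
    {N : ℕ} (h : exec I P s = PMF.pure (s', 1)) (hQ : Reach I (block l) s' R (N : ℕ)) :
    Reach I (block (P :: l)) s R ((N + 1 : ℕ) : ℝ≥0∞) :=
  (Reach.seq_exec h hQ).mono (fun _ h => h) (by push_cast; rw [add_comm])

theorem Sim.step {P : RAMProgram} {l : List RAMProgram} {s s' : RAMStore} {q : PMF β}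
    {R : RAMStore → β → Prop}
    {N : ℕ} (h : exec I P s = PMF.pure (s', 1)) (hQ : Sim I (block l) s' q R (N : ℕ)) :
    Sim I (block (P :: l)) s q R ((N + 1 : ℕ) : ℝ≥0∞) :=
  (Sim.seq_exec h hQ).mono (fun _ _ h => h) (by push_cast; rw [add_comm])

theorem Reach.one {P : RAMProgram} {s s' : RAMStore} {R : RAMStore → Prop}
    (h : exec I P s = PMF.pure (s', 1)) (hR : R s') : Reach I P s R ((1 : ℕ) : ℝ≥0∞) :=
  Reach.of_exec h hR

theorem Reach.nil {s : RAMStore} {R : RAMStore → Prop} (hR : R s) :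
    Reach I (block []) s R ((1 : ℕ) : ℝ≥0∞) := Reach.of_exec rfl hR

theorem Reach.cons {P : RAMProgram} {l : List RAMProgram} {s : RAMStore} {R R' : RAMStore → Prop}
    {N N' : ℕ} (hP : Reach I P s R N)
    (hQ : ∀ s', R s' → Agree P.intWrites P.realWrites P.arrWrites s s' → Reach I (block l) s' R' N') :
    Reach I (block (P :: l)) s R' ((N + N' : ℕ) : ℝ≥0∞) :=
  (hP.frame.seq fun s' hs' => hQ s' hs'.1 hs'.2).mono (fun _ h => h) (by push_cast; rfl)

theorem Sim.cons_reach {P : RAMProgram} {l : List RAMProgram} {s : RAMStore} {q : PMF β}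
    {R R' : RAMStore → β → Prop} {N N' : ℕ} (hP : Sim I P s q R N)
    (hQ : ∀ s' b, R s' b → Agree P.intWrites P.realWrites P.arrWrites s s' →
      Reach I (block l) s' (fun s'' => R' s'' b) N') :
    Sim I (block (P :: l)) s q R' ((N + N' : ℕ) : ℝ≥0∞) :=
  (hP.frame.seq_reach fun s' b hs' => hQ s' b hs'.1 hs'.2).mono (fun _ _ h => h) (by push_cast; rfl)

theorem Sim.flip_map {P Q : RAMProgram} {s : RAMStore} {a N : ℕ} {p : ℝ} {f : Bool → β}
    {R : RAMStore → β → Prop} (hp : s.real a = p)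
    (hP : Reach I P s (fun s' => R s' (f true)) N) (hQ : Reach I Q s (fun s' => R s' (f false)) N) :
    Sim I (RAMProgram.flip a P Q) s ((coin p).map f) R ((N + 1 : ℕ) : ℝ≥0∞) := by
  rw [← PMF.bind_pure_comp, ← hp]
  refine (Sim.flip (h := fun b => PMF.pure (f b)) (hP.sim fun _ h => h)
    (hQ.sim fun _ h => h)).mono (fun _ _ h => h) ?_
  have : coin (s.real a) true + coin (s.real a) false = 1 := by
    rw [← Fintype.sum_bool, ← tsum_fintype (L := .unconditional Bool), PMF.tsum_coe]
  rw [← add_mul, this]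
  push_cast
  rw [one_mul]

theorem Reach.loop_frame {P : RAMProgram} {s : RAMStore} {a N K : ℕ}
    {R : ℕ → RAMStore → Prop} (ha : s.int a = N) (h0 : R 0 s)
    (hP : ∀ i < N, ∀ s', R i s' → Agree P.intWrites P.realWrites P.arrWrites s s' →
      Reach I P s' (R (i + 1)) K) :
    Reach I (RAMProgram.loop a P) s (R N) ((N * (K + 1) + 1 : ℕ) : ℝ≥0∞) :=
  (Reach.loop (R := fun i s' => R i s' ∧ Agree P.intWrites P.realWrites P.arrWrites s s') ha
    ⟨h0, Agree.refl _ _ _ _⟩ fun i hi s' hs' =>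
      (hP i hi s' hs'.1 hs'.2).frame.mono (fun _ h => ⟨h.1, hs'.2.trans h.2⟩) le_rfl).mono
    (fun _ h => h.1) (by push_cast; rfl)

theorem Sim.loop_frame {P : RAMProgram} {s : RAMStore} {a N K : ℕ} {q : ℕ → PMF β}
    {h : ℕ → β → PMF β} {R : ℕ → RAMStore → β → Prop} {b₀ : β} (ha : s.int a = N)
    (h0 : R 0 s b₀) (hq0 : q 0 = PMF.pure b₀) (hq : ∀ i < N, q (i + 1) = (q i).bind (h i))
    (hP : ∀ i < N, ∀ s' b, R i s' b → Agree P.intWrites P.realWrites P.arrWrites s s' →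
      Sim I P s' (h i b) (R (i + 1)) K) :
    Sim I (RAMProgram.loop a P) s (q N) (R N) ((N * (K + 1) + 1 : ℕ) : ℝ≥0∞) :=
  (Sim.loop (R := fun i s' b => R i s' b ∧ Agree P.intWrites P.realWrites P.arrWrites s s') ha
    ⟨h0, Agree.refl _ _ _ _⟩ hq0 hq fun i hi s' b hs' =>
      (hP i hi s' b hs'.1 hs'.2).frame.mono (fun _ _ h => ⟨h.1, hs'.2.trans h.2⟩) le_rfl).mono
    (fun _ _ h => h.1) (by push_cast; rfl)

theorem Reach.ifIntLt_nat {P Q : RAMProgram} {s : RAMStore} {a b N : ℕ} {R : RAMStore → Prop}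
    (hP : s.int a < s.int b → Reach I P s R N)
    (hQ : s.int b ≤ s.int a → Reach I Q s R N) :
    Reach I (RAMProgram.ifIntLt a b P Q) s R ((N + 1 : ℕ) : ℝ≥0∞) :=
  (Reach.ifIntLt hP hQ).mono (fun _ h => h) (by push_cast; rfl)

theorem Reach.ifRealLt_nat {P Q : RAMProgram} {s : RAMStore} {a b N : ℕ} {R : RAMStore → Prop}
    (hP : s.real a < s.real b → Reach I P s R N)
    (hQ : s.real b ≤ s.real a → Reach I Q s R N) :
    Reach I (RAMProgram.ifRealLt a b P Q) s R ((N + 1 : ℕ) : ℝ≥0∞) :=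
  (Reach.ifRealLt hP hQ).mono (fun _ h => h) (by push_cast; rfl)

theorem Reach.mono_nat {P : RAMProgram} {s : RAMStore} {R R' : RAMStore → Prop}
    {N N' : ℕ} (h : Reach I P s R N) (hR : ∀ s', R s' → R' s') (hN : N ≤ N') :
    Reach I P s R' N' := h.mono hR (by exact_mod_cast hN)

theorem Sim.mono_nat {P : RAMProgram} {s : RAMStore} {q : PMF β} {R R' : RAMStore → β → Prop}
    {N N' : ℕ} (h : Sim I P s q R N) (hR : ∀ s' b, R s' b → R' s' b) (hN : N ≤ N') :
    Sim I P s q R' N' := h.mono hR (by exact_mod_cast hN)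

end RAMProgram

/-! ### The program -/

namespace MEBProgram

open RAMProgram

/-- Draw a row by the weights in array `1`, into the integer register `8`. -/
def sampleRow : RAMProgram :=
  block [intConst 9 0, intConst 8 0, realConst 5 0,
    loop 0 (block [load 6 1 9, realOp .add 5 5 6, realOp .div 7 6 5,
      flip 7 (intAdd 8 9 12) skip, intAdd 9 9 3])]

/-- Draw a column by walking down the tree in array `4`, into the integer register `10`. -/
def sampleCol : RAMProgram :=
  block [intConst 10 1,
    loop 5 (block [load 5 4 10, intAdd 10 10 10, load 6 4 10, realOp .div 7 6 5,
      flip 7 skip (intAdd 10 10 3)]),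
    intSub 10 10 4]

/-- Update the weights in array `1`. -/
def updateWeights : RAMProgram :=
  block [load 8 3 10, intConst 9 0,
    loop 0 (block [readEntry 5 9 10, realOp .mul 5 14 5, realOp .mul 5 5 4, realOp .div 5 5 8,
      readNorm 6 9, realOp .mul 6 6 6, realOp .add 5 5 6, realOp .add 5 5 4,
      ifRealLt 5 3 (realOp .add 5 3 13) skip, ifRealLt 2 5 (realOp .add 5 2 13) skip,
      realOp .mul 6 0 5, realOp .mul 7 6 6, realOp .add 6 6 7, realOp .add 6 15 6,
      load 7 1 9, realOp .mul 7 7 6, store 1 9 7, intAdd 9 9 3])]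

/-- Recompute the inner nodes of the tree in array `4`. -/
def buildTree : RAMProgram :=
  block [intAdd 9 4 12,
    loop 4 (block [intSub 9 9 3, intAdd 10 9 9, load 7 4 10, intAdd 10 10 3, load 8 4 10,
      realOp .add 7 7 8, store 4 9 7])]

/-- Add the pending multiple of the primal point to the total in array `0`, the chosen row to
array `2`, and put the new primal point into array `3` and its squared coordinates into the leaves
of the tree. -/
def movePoint : RAMProgram :=
  block [intAdd 6 6 3, realOfInt 5 6, realOfInt 6 7, realConst 4 0, intConst 9 0, intAdd 10 4 12,
    loop 1 (block [load 7 0 9, load 8 3 9, realOp .mul 8 6 8, realOp .add 7 7 8, store 0 9 7,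
      load 7 2 9, readEntry 8 8 9, realOp .add 7 7 8, store 2 9 7,
      realOp .div 7 7 5, store 3 9 7, realOp .mul 7 7 7, realOp .add 4 4 7, store 4 10 7,
      intAdd 9 9 3, intAdd 10 10 3]),
    intConst 7 0]

/-- One iteration of the algorithm. -/
def iteration : RAMProgram :=
  block [sampleRow, sampleCol, updateWeights, intAdd 7 7 3,
    flip 1 (block [movePoint, buildTree]) skip]

/-- Compute the parameters of the algorithm. -/
def setParams : RAMProgram :=
  block [intRows 0, intCols 1, intConst 3 1, realOfInt 5 0, realLog 5 5, realConst 6 40000,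
    realOp .mul 6 6 5, realEps 7, realOp .mul 7 7 7, realOp .div 6 6 7, intCeil 2 6, realOfInt 12 2,
    realOp .div 6 5 12, realSqrt 0 6, realLog 6 12, realOp .mul 7 12 5, realSqrt 7 7,
    realOp .div 1 6 7, realConst 15 1, realOp .div 2 15 0, realOp .sub 3 13 2, realConst 14 (-2)]

/-- Set all weights to `1`. -/
def setWeights : RAMProgram :=
  block [intConst 9 0, loop 0 (block [store 1 9 15, intAdd 9 9 3])]

/-- Compute the size and the depth of the tree. -/
def setDepth : RAMProgram :=
  block [intConst 4 1, loop 1 (ifIntLt 4 1 (block [intAdd 4 4 4, intAdd 5 5 3]) skip)]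

/-- The parameters and the initial values. -/
def setup : RAMProgram := block [setParams, setWeights, setDepth]

/-- Complete the total and divide it by the number of iterations. -/
def finish : RAMProgram :=
  block [realOfInt 6 7, intConst 9 0,
    loop 1 (block [load 7 0 9, load 8 3 9, realOp .mul 8 6 8, realOp .add 7 7 8,
      realOp .div 7 7 12, store 0 9 7, intAdd 9 9 3])]

/-- The sublinear primal-dual algorithm. -/
def program : RAMProgram := block [setup, loop 2 iteration, finish]

/-- The contents of the registers that stay fixed after the setup. -/
structure Consts (n d T L : ℕ) (η α : ℝ) (s : RAMStore) : Prop where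
  rows : s.int 0 = n
  cols : s.int 1 = d
  one : s.int 3 = 1
  cap : s.int 4 = 2 ^ L
  depth : s.int 5 = L
  zero : s.int 12 = 0
  eta : s.real 0 = η
  alpha : s.real 1 = α
  upper : s.real 2 = 1 / η
  lower : s.real 3 = -(1 / η)
  iters : s.real 12 = T
  rzero : s.real 13 = 0
  negTwo : s.real 14 = -2
  rone : s.real 15 = 1

theorem Consts.of_agree {n d T L : ℕ} {η α : ℝ} {s s' : RAMStore} (h : Consts n d T L η α s)
    {li lr la : List ℕ} (ha : Agree li lr la s s')
    (hi : ∀ r ∈ [0, 1, 3, 4, 5, 12], r ∉ li) (hr : ∀ r ∈ [0, 1, 2, 3, 12, 13, 14, 15], r ∉ lr) :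
    Consts n d T L η α s' where
  rows := (ha.int 0 (hi 0 (by simp))).trans h.rows
  cols := (ha.int 1 (hi 1 (by simp))).trans h.cols
  one := (ha.int 3 (hi 3 (by simp))).trans h.one
  cap := (ha.int 4 (hi 4 (by simp))).trans h.cap
  depth := (ha.int 5 (hi 5 (by simp))).trans h.depth
  zero := (ha.int 12 (hi 12 (by simp))).trans h.zero
  eta := (ha.real 0 (hr 0 (by simp))).trans h.eta
  alpha := (ha.real 1 (hr 1 (by simp))).trans h.alpha
  upper := (ha.real 2 (hr 2 (by simp))).trans h.upper
  lower := (ha.real 3 (hr 3 (by simp))).trans h.lower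
  iters := (ha.real 12 (hr 12 (by simp))).trans h.iters
  rzero := (ha.real 13 (hr 13 (by simp))).trans h.rzero
  negTwo := (ha.real 14 (hr 14 (by simp))).trans h.negTwo
  rone := (ha.real 15 (hr 15 (by simp))).trans h.rone

/-! ### Correctness and cost of the subroutines. -/

variable {I : RAMInput} {n d T L : ℕ} {η α : ℝ}

theorem sim_sampleRow [NeZero n] {s : RAMStore} (hs : Consts n d T L η α s)
    (hpos : ∀ r < n, 0 < s.arr 1 r) :
    Sim I sampleRow s (sampleWeights fun i : Fin n => s.arr 1 i) (fun s' i => s'.int 8 = i)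
      ((8 * n + 5 : ℕ) : ℝ≥0∞) := by
  refine (Sim.of_map ?_ (reservoir_eq hpos) (R := fun s' (i : ℕ) => s'.int 8 = i)
    fun _ _ h => h).mono_nat (N := n * (7 + 1) + 1 + 1 + 1 + 1 + 1) (fun _ _ h => h) (by omega)
  refine Sim.step rfl (Sim.step rfl (Sim.step rfl (Sim.cons_reach ?_ ?_ (N' := 1)
    (R := fun s' i => s'.int 8 = i))))
  · refine (Sim.loop_frame (R := fun k s' (b : ℕ) => s'.int 9 = k ∧ s'.int 8 = b ∧
      s'.real 5 = ∑ r ∈ Finset.range k, s.arr 1 r) (q := reservoir (s.arr 1)) (b₀ := 0) (N := n)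
      (h := fun k i => (coin (s.arr 1 k / ∑ r ∈ Finset.range (k + 1), s.arr 1 r)).map
        fun b => cond b k i) (K := 7)
      (by simpa using hs.rows) (by simp) rfl (fun _ _ => rfl) ?_).mono
      (fun _ _ h => h.2.1) le_rfl
    intro k hk s' b ⟨h9, h8, h5⟩ ha
    have h1 : s'.arr 1 = s.arr 1 := ha.arr 1 (by decide)
    have h3 : s'.int 3 = 1 := (ha.int 3 (by decide)).trans (by simpa using hs.one)
    have h12 : s'.int 12 = 0 := (ha.int 12 (by decide)).trans (by simpa using hs.zero)
    refine Sim.step rfl (Sim.step rfl (Sim.step rfl (Sim.cons_reach (N := 1 + 1) (N' := 1 + 1)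
      (R := fun s' b => s'.int 9 = k ∧ s'.int 8 = b ∧
      s'.real 5 = ∑ r ∈ Finset.range (k + 1), s.arr 1 r)
      (Sim.flip_map ?_ (Reach.one rfl ?_) (Reach.one rfl ?_)) ?_)))
    · simp [RealOp.eval, h1, h9, h5, Finset.sum_range_succ]
    · simp [RealOp.eval, h1, h9, h5, Finset.sum_range_succ, h12]
    · simp [RealOp.eval, h1, h9, h5, Finset.sum_range_succ, h8]
    · intro s'' b' ⟨h9', h8', h5'⟩ ha'
      have h3' : s''.int 3 = 1 := (ha'.int 3 (by decide)).trans (by simpa using h3)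
      exact Reach.step rfl (Reach.nil (by simp [h9', h8', h5', h3']))
  · intro s' b h _
    exact Reach.nil h

/-- The tree in array `4` holds the squared coordinates of the point in array `3`. -/
structure IsTree (d L : ℕ) (s : RAMStore) : Prop where
  add : ∀ v, 1 ≤ v → v < 2 ^ L → s.arr 4 v = s.arr 4 (v + v) + s.arr 4 (v + v + 1)
  leaf : ∀ k < d, s.arr 4 (2 ^ L + k) = s.arr 3 k ^ 2
  pad : ∀ k, d ≤ k → k < 2 ^ L → s.arr 4 (2 ^ L + k) = 0

/-- No assumption on the tree is made, so that the cost bound is also available for a tree of zeros,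
where the walk does not sample the intended distribution. -/
theorem sim_heapWalk {s : RAMStore} (hs : Consts n d T L η α s) :
    Sim I sampleCol s (heapWalk (s.arr 4) L) (fun s' v => s'.int 10 = v - 2 ^ L)
      ((8 * L + 4 : ℕ) : ℝ≥0∞) := by
  refine Sim.mono_nat (N := L * (7 + 1) + 1 + 2 + 1) (R := fun s' v => s'.int 10 = v - 2 ^ L) ?_
    (fun _ _ h => h) (by omega)
  refine Sim.step (s' := s.setInt 10 1) rfl (Sim.cons_reach (N := L * (7 + 1) + 1) (N' := 2)
    (R := fun s' v => s'.int 10 = v) ?_ ?_)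
  · refine (Sim.loop_frame (R := fun k s' (v : ℕ) => s'.int 10 = v) (q := heapWalk (s.arr 4))
      (b₀ := 1) (N := L) (K := 7) (by simpa using hs.depth) (by simp) rfl (fun _ _ => rfl) ?_)
    intro k hk s' b h10 ha
    have h4 : s'.arr 4 = s.arr 4 := ha.arr 4 (by decide)
    have h3 : s'.int 3 = 1 := (ha.int 3 (by decide)).trans (by simpa using hs.one)
    refine Sim.step rfl (Sim.step rfl (Sim.step rfl (Sim.step rfl (Sim.cons_reach (N := 1 + 1)
      (N' := 0 + 1) (R := fun s' v => s'.int 10 = v)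
      (Sim.flip_map ?_ (Reach.one rfl ?_) (Reach.one rfl ?_)) ?_))))
    · simp [RealOp.eval, h4, h10]
    · simp [h10]
    · simp [h10, h3]
    · intro s'' b' h _
      exact Reach.nil h
  · intro s' v h ha
    have h4 : s'.int 4 = 2 ^ L := (ha.int 4 (by decide)).trans (by simpa using hs.cap)
    exact Reach.step (N := 1) rfl (Reach.nil (by simp [h, h4]))

/-- If all coordinates vanish, the column that the program chooses is arbitrary. -/
theorem sim_sampleCol [NeZero d] {s : RAMStore} (hs : Consts n d T L η α s) (hd : d ≤ 2 ^ L)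
    (ht : IsTree d L s) :
    Sim I sampleCol s (sampleWeights fun j : Fin d => s.arr 3 j ^ 2)
      (fun s' j => s'.int 10 = j ∨ ∀ j : Fin d, s.arr 3 j = 0) ((8 * L + 4 : ℕ) : ℝ≥0∞) := by
  -- For the zero point the target is uniform, whereas the walk in a zero tree always turns right
  -- and may even end on a padding leaf; the relation then demands nothing of the column.
  by_cases h0 : ∀ j : Fin d, s.arr 3 j = 0
  · exact ((sim_heapWalk hs).to_reach fun _ _ _ => trivial).sim_of_forall _
      fun _ _ _ => Or.inr h0
  · push Not at h0
    obtain ⟨j, hj⟩ := h0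
    refine (sim_heapWalk hs).of_map (heapWalk_eq (fun _ => sq_nonneg _)
      (Finset.sum_pos' (fun _ _ => sq_nonneg _) ⟨j, Finset.mem_univ _, by positivity⟩) hd ht.add
      (fun k => ht.leaf k k.2) ht.pad) fun s' j h => Or.inl (by rw [h]; simp)

/-- The weight factor of a row in an iteration, computed from the contents of the store. -/
noncomputable def weightFactor (I : RAMInput) (η : ℝ) (s : RAMStore) (r : ℕ) : ℝ :=
  let v := clip (-2 * I.entry r (s.int 10) * s.real 4 / s.arr 3 (s.int 10) + I.rowNorm r ^ 2 +
    s.real 4) (1 / η)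
  1 + η * v + η ^ 2 * v ^ 2

theorem reach_clip {l : List RAMProgram} {t : RAMStore} {z V : ℝ} {R : RAMStore → Prop} {N : ℕ}
    (e5 : t.real 5 = z) (e3 : t.real 3 = -V) (e2 : t.real 2 = V) (e13 : t.real 13 = 0)
    (h : ∀ t', t'.real 5 = clip z V → Agree [] [5] [] t t' → Reach I (block l) t' R (N : ℕ)) :
    Reach I (block (ifRealLt 5 3 (realOp .add 5 3 13) skip ::
      ifRealLt 2 5 (realOp .add 5 2 13) skip :: l)) t R ((2 + (2 + N) : ℕ) : ℝ≥0∞) := by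
  refine Reach.cons (N := 1 + 1) (R := fun t => t.real 5 = max (-V) z)
    (Reach.ifRealLt_nat (fun h => Reach.one rfl ?_) fun h => Reach.one rfl ?_) fun t₁ h₁ a₁ => ?_
  · rw [e5, e3] at h
    simp [RealOp.eval, e3, e13, max_eq_left h.le]
  · rw [e5, e3] at h
    rw [e5, max_eq_right h]
  have e2' : t₁.real 2 = V := (a₁.real 2 (by decide)).trans e2
  have e13' : t₁.real 13 = 0 := (a₁.real 13 (by decide)).trans e13
  refine Reach.cons (N := 1 + 1) (R := fun t => t.real 5 = clip z V)
    (Reach.ifRealLt_nat (fun h => Reach.one rfl ?_) fun h => Reach.one rfl ?_) fun t₂ h₂ a₂ => ?_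
  · rw [e2', h₁] at h
    simp [RealOp.eval, e2', e13', clip, min_eq_left h.le]
  · rw [e2', h₁] at h
    rw [h₁, clip, min_eq_right h]
  exact h t₂ h₂ ((a₁.mono (by decide) (by decide) (by decide)).trans
    (a₂.mono (by decide) (by decide) (by decide)))

theorem reach_updateWeights {s : RAMStore} (hs : Consts n d T L η α s) :
    Reach I updateWeights s
      (fun s' => ∀ r < n, s'.arr 1 r = s.arr 1 r * weightFactor I η s r)
      ((22 * n + 4 : ℕ) : ℝ≥0∞) := by
  refine Reach.mono_nat (N := n * (21 + 1) + 1 + 1 + 1 + 1) ?_ (fun _ h => h) (by omega)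
  refine Reach.step rfl (Reach.step rfl (Reach.cons (N' := 1) (R := fun s' =>
    ∀ r < n, s'.arr 1 r = s.arr 1 r * weightFactor I η s r) ?_ fun s' h _ => Reach.nil h))
  refine (Reach.loop_frame (R := fun k s' => s'.int 9 = k ∧
    ∀ r, s'.arr 1 r = if r < k then s.arr 1 r * weightFactor I η s r else s.arr 1 r)
    (N := n) (K := 21) (by simpa using hs.rows) (by simp) ?_).mono
    (fun s' h r hr => by rw [h.2, if_pos hr]) le_rfl
  intro k hk s' ⟨h9, h1⟩ ha
  have h3 : s'.int 3 = 1 := (ha.int 3 (by decide)).trans (by simpa using hs.one)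
  have h10 : s'.int 10 = s.int 10 := (ha.int 10 (by decide)).trans (by simp)
  have e14 : s'.real 14 = -2 := (ha.real 14 (by decide)).trans (by simpa using hs.negTwo)
  have e13 : s'.real 13 = 0 := (ha.real 13 (by decide)).trans (by simpa using hs.rzero)
  have e15 : s'.real 15 = 1 := (ha.real 15 (by decide)).trans (by simpa using hs.rone)
  have e0 : s'.real 0 = η := (ha.real 0 (by decide)).trans (by simpa using hs.eta)
  have e2 : s'.real 2 = 1 / η := (ha.real 2 (by decide)).trans (by simpa using hs.upper)
  have e3 : s'.real 3 = -(1 / η) := (ha.real 3 (by decide)).trans (by simpa using hs.lower)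
  have e4 : s'.real 4 = s.real 4 := (ha.real 4 (by decide)).trans (by simp)
  have e8 : s'.real 8 = s.arr 3 (s.int 10) := (ha.real 8 (by decide)).trans (by simp)
  set z := -2 * I.entry k (s.int 10) * s.real 4 / s.arr 3 (s.int 10) + I.rowNorm k ^ 2 +
    s.real 4 with hz
  refine Reach.step rfl <| Reach.step rfl <| Reach.step rfl <| Reach.step rfl <|
    Reach.step rfl <| Reach.step rfl <| Reach.step rfl <| Reach.step rfl <|
    reach_clip (N := 9) (z := z) ?_ (by simpa using e3) (by simpa using e2) (by simpa using e13)
      fun t t5 ht => ?_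
  · simp only [RealOp.eval, RAMStore.int_setReal, RAMStore.real_setReal, h9, h10, e14, e4, e8, hz]
    norm_num
    ring
  have t0 : t.real 0 = η := (ht.real 0 (by decide)).trans (by simpa using e0)
  have t15 : t.real 15 = 1 := (ht.real 15 (by decide)).trans (by simpa using e15)
  have t9 : t.int 9 = k := (ht.int 9 (by decide)).trans (by simpa using h9)
  have t3 : t.int 3 = 1 := (ht.int 3 (by decide)).trans (by simpa using h3)
  have ta : t.arr 1 = s'.arr 1 := (ht.arr 1 (by decide)).trans (by simp)
  refine Reach.step rfl <| Reach.step rfl <| Reach.step rfl <| Reach.step rfl <|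
    Reach.step rfl <| Reach.step rfl <| Reach.step rfl <| Reach.step rfl <| Reach.nil ⟨?_, ?_⟩
  · simp [t9, t3]
  · intro r
    have hf : weightFactor I η s k = 1 + (η * clip z (1 / η) +
      η * clip z (1 / η) * (η * clip z (1 / η))) := by
      simp only [weightFactor, ← hz]
      ring
    rcases lt_trichotomy r k with h | h | h
    · simp [t9, ta, h1, h.ne, h, h.trans (Nat.lt_succ_self k)]
    · simp [RealOp.eval, h, t9, ta, h1, hf, t5, t0, t15]
    · simp [t9, ta, h1, h.ne', h.not_gt, (Nat.succ_le_of_lt h).not_gt]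

/-- Nodes are recomputed in decreasing order, children before parents. The last of the `2 ^ L`
rounds writes the cell `0`, which is not a node. -/
theorem reach_buildTree {s : RAMStore} (hs : Consts n d T L η α s) :
    Reach I buildTree s (fun s' =>
      (∀ v, 2 ^ L ≤ v → s'.arr 4 v = s.arr 4 v) ∧
      ∀ v, 1 ≤ v → v < 2 ^ L → s'.arr 4 v = s'.arr 4 (v + v) + s'.arr 4 (v + v + 1))
      ((9 * 2 ^ L + 3 : ℕ) : ℝ≥0∞) := by
  set D := 2 ^ L with hD
  refine Reach.mono_nat (N := D * (8 + 1) + 1 + 1 + 1) (R := fun s' =>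
      (∀ v, D ≤ v → s'.arr 4 v = s.arr 4 v) ∧
      ∀ v, 1 ≤ v → v < D → s'.arr 4 v = s'.arr 4 (v + v) + s'.arr 4 (v + v + 1)) ?_
    (fun _ h => h) (by omega)
  refine Reach.step (s' := s.setInt 9 (s.int 4 + s.int 12)) rfl
    (Reach.cons (N := D * (8 + 1) + 1) (N' := 1) (R := fun s' =>
      (∀ v, D ≤ v → s'.arr 4 v = s.arr 4 v) ∧
      ∀ v, 1 ≤ v → v < D → s'.arr 4 v = s'.arr 4 (v + v) + s'.arr 4 (v + v + 1)) ?_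
      fun s' h _ => Reach.nil h)
  refine (Reach.loop_frame (R := fun k s' => s'.int 9 = D - k ∧
      (∀ v, D ≤ v → s'.arr 4 v = s.arr 4 v) ∧
      ∀ v, 1 ≤ v → D - k ≤ v → v < D → s'.arr 4 v = s'.arr 4 (v + v) + s'.arr 4 (v + v + 1))
    (N := D) (K := 8) (by simpa using hs.cap) ⟨?_, ?_, ?_⟩ ?_).mono
    (fun s' h => ⟨h.2.1, fun v hv hv' => h.2.2 v hv (by omega) hv'⟩) le_rfl
  · simp [hs.cap, hs.zero, hD]
  · intro v _
    simp
  · intro v _ h h'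
    omega
  intro k hk s' ⟨h9, hleaf, hadd⟩ ha
  have h3 : s'.int 3 = 1 := (ha.int 3 (by decide)).trans (by simpa using hs.one)
  refine Reach.step rfl <| Reach.step rfl <| Reach.step rfl <| Reach.step rfl <|
    Reach.step rfl <| Reach.step rfl <| Reach.step rfl <| Reach.nil ⟨?_, ?_, ?_⟩
  · simp [h9, h3]
    omega
  · intro v hv
    have : v ≠ D - k - 1 := by omega
    simp [h9, h3, this, hleaf v hv]
  · intro v hv hv' hvD
    -- The cell written now is not a child of any node treated so far, so the sums already
    -- established survive.
    have e1 : v + v ≠ D - k - 1 := by omega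
    have e2 : v + v + 1 ≠ D - k - 1 := by omega
    by_cases h : v = D - k - 1
    · rw [← h] at e1 e2
      simp only [RealOp.eval, RAMStore.int_setInt, RAMStore.int_setReal,
        RAMStore.real_setInt, RAMStore.real_setReal, RAMStore.arr_setInt,
        RAMStore.arr_setReal, RAMStore.arr_setArr, Nat.reduceEqDiff,
        if_true, if_false, h9, h3, ← h, e1, e2]
    · simp [h9, h3, h, e1, e2]
      exact hadd v hv (by omega) hvD

/-- Advances by one cell the invariant of a loop that overwrites an array from left to right. -/
theorem ite_lt_succ {M : Type*} {f a b : ℕ → M} {c : M} {k : ℕ}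
    (hf : ∀ r, f r = if r < k then a r else b r) (hc : c = a k) (r : ℕ) :
    (if r = k then c else f r) = if r < k + 1 then a r else b r := by
  rcases lt_trichotomy r k with h | h | h
  · rw [if_neg h.ne, hf, if_pos h, if_pos (by omega)]
  · rw [if_pos h, if_pos (by omega), hc, h]
  · rw [if_neg h.ne', hf, if_neg (by omega), if_neg (by omega)]

/-- In each coordinate the pending multiple of the old point is added to the total before the point
is overwritten. The last clause keeps the padding leaves of the tree as they were. -/
theorem reach_movePoint {s : RAMStore} (hs : Consts n d T L η α s) :
    Reach I movePoint s (fun s' =>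
      s'.int 6 = s.int 6 + 1 ∧ s'.int 7 = 0 ∧
      s'.real 4 = ∑ r ∈ Finset.range d, s'.arr 3 r ^ 2 ∧
      (∀ r < d, s'.arr 0 r = s.arr 0 r + s.int 7 * s.arr 3 r) ∧
      (∀ r < d, s'.arr 2 r = s.arr 2 r + I.entry (s.int 8) r) ∧
      (∀ r < d, s'.arr 3 r = (s.arr 2 r + I.entry (s.int 8) r) / (s.int 6 + 1 : ℕ)) ∧
      (∀ r < d, s'.arr 4 (2 ^ L + r) = s'.arr 3 r ^ 2) ∧
      ∀ v, 2 ^ L + d ≤ v → s'.arr 4 v = s.arr 4 v)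
      ((18 * d + 9 : ℕ) : ℝ≥0∞) := by
  set D := 2 ^ L with hD
  set x' : ℕ → ℝ := fun r => (s.arr 2 r + I.entry (s.int 8) r) / (s.int 6 + 1 : ℕ) with hx'
  refine Reach.mono_nat (N := d * (17 + 1) + 1 + 2 + 6)
    (R := fun s' => s'.int 6 = s.int 6 + 1 ∧ s'.int 7 = 0 ∧
      s'.real 4 = ∑ r ∈ Finset.range d, x' r ^ 2 ∧
      (∀ r, s'.arr 0 r = if r < d then s.arr 0 r + s.int 7 * s.arr 3 r else s.arr 0 r) ∧
      (∀ r, s'.arr 2 r = if r < d then s.arr 2 r + I.entry (s.int 8) r else s.arr 2 r) ∧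
      (∀ r, s'.arr 3 r = if r < d then x' r else s.arr 3 r) ∧
      (∀ r < d, s'.arr 4 (D + r) = x' r ^ 2) ∧
      ∀ v, D + d ≤ v → s'.arr 4 v = s.arr 4 v) ?_ ?_ (by omega)
  · refine Reach.step rfl <| Reach.step rfl <| Reach.step rfl <| Reach.step rfl <|
      Reach.step rfl <| Reach.step rfl <| Reach.cons (N := d * (17 + 1) + 1) (N' := 2)
      (R := fun s' => s'.real 4 = ∑ r ∈ Finset.range d, x' r ^ 2 ∧
      (∀ r, s'.arr 0 r = if r < d then s.arr 0 r + s.int 7 * s.arr 3 r else s.arr 0 r) ∧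
      (∀ r, s'.arr 2 r = if r < d then s.arr 2 r + I.entry (s.int 8) r else s.arr 2 r) ∧
      (∀ r, s'.arr 3 r = if r < d then x' r else s.arr 3 r) ∧
      (∀ r < d, s'.arr 4 (D + r) = x' r ^ 2) ∧
      ∀ v, D + d ≤ v → s'.arr 4 v = s.arr 4 v) ?_ ?_
    · refine (Reach.loop_frame (R := fun k s' => s'.int 9 = k ∧ s'.int 10 = D + k ∧
        s'.real 4 = ∑ r ∈ Finset.range k, x' r ^ 2 ∧
        (∀ r, s'.arr 0 r = if r < k then s.arr 0 r + s.int 7 * s.arr 3 r else s.arr 0 r) ∧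
        (∀ r, s'.arr 2 r = if r < k then s.arr 2 r + I.entry (s.int 8) r else s.arr 2 r) ∧
        (∀ r, s'.arr 3 r = if r < k then x' r else s.arr 3 r) ∧
        (∀ r < k, s'.arr 4 (D + r) = x' r ^ 2) ∧
        ∀ v, D + k ≤ v → s'.arr 4 v = s.arr 4 v)
        (N := d) (K := 17) (by simpa using hs.cols) (by simp [hs.cap, hs.zero, hD]) ?_).mono
        (fun s' h => h.2.2) le_rfl
      intro k hk s' ⟨h9, h10, e4, ht, hy, hx, hl, hr⟩ ha
      have h3 : s'.int 3 = 1 := (ha.int 3 (by decide)).trans (by simpa using hs.one)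
      have h8 : s'.int 8 = s.int 8 := (ha.int 8 (by decide)).trans (by simp)
      have e5 : s'.real 5 = (s.int 6 + 1 : ℕ) :=
        (ha.real 5 (by decide)).trans (by simp [hs.one])
      have e6 : s'.real 6 = s.int 7 := (ha.real 6 (by decide)).trans (by simp)
      have hyk : s'.arr 2 k = s.arr 2 k := by rw [hy, if_neg (lt_irrefl k)]
      refine Reach.step rfl <| Reach.step rfl <| Reach.step rfl <| Reach.step rfl <|
        Reach.step rfl <| Reach.step rfl <| Reach.step rfl <| Reach.step rfl <|
        Reach.step rfl <| Reach.step rfl <| Reach.step rfl <| Reach.step rfl <|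
        Reach.step rfl <| Reach.step rfl <| Reach.step rfl <| Reach.step rfl <|
        Reach.nil ⟨?_, ?_, ?_, ?_, ?_, ?_, ?_, ?_⟩
      all_goals
        simp only [RealOp.eval, RAMStore.int_setInt, RAMStore.int_setReal, RAMStore.int_setArr,
          RAMStore.real_setInt, RAMStore.real_setReal, RAMStore.real_setArr, RAMStore.arr_setInt,
          RAMStore.arr_setReal, RAMStore.arr_setArr, Nat.reduceEqDiff,
          if_true, if_false, h9, h10, h3, h8, e4, e5, e6]
      · rfl
      · rw [Finset.sum_range_succ, hyk, ← sq]
      · exact ite_lt_succ ht (by rw [ht, if_neg (lt_irrefl k), hx, if_neg (lt_irrefl k)])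
      · exact ite_lt_succ hy (by rw [hyk])
      · exact ite_lt_succ hx (by rw [hyk])
      · intro r hr
        rcases eq_or_ne r k with rfl | h
        · rw [if_pos rfl, hyk, ← sq]
        · rw [if_neg (by omega), hl r (by omega)]
      · intro v hv
        rw [if_neg (by omega), hr v (by omega)]
    · intro s' h ha
      have h6 : s'.int 6 = s.int 6 + 1 := (ha.int 6 (by decide)).trans (by simp [hs.one])
      exact Reach.step (N := 1) rfl (Reach.nil (by simpa [h6] using h))
  · rintro s' ⟨h6, h7, e4, ht, hy, hx, hl, hr⟩
    have hx'' : ∀ r < d, s'.arr 3 r = x' r := fun r h => by rw [hx, if_pos h]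
    refine ⟨h6, h7, ?_, fun r h => by rw [ht, if_pos h], fun r h => by rw [hy, if_pos h], hx'',
      fun r h => by rw [hl r h, hx'' r h], hr⟩
    rw [e4]
    exact Finset.sum_congr rfl fun r h => by rw [hx'' r (Finset.mem_range.1 h)]

theorem reach_finish {s : RAMStore} (hs : Consts n d T L η α s) :
    Reach I finish s (fun s' =>
      ∀ r < d, s'.arr 0 r = (s.arr 0 r + s.int 7 * s.arr 3 r) / T)
      ((9 * d + 4 : ℕ) : ℝ≥0∞) := by
  refine Reach.mono_nat (N := d * (8 + 1) + 1 + 1 + 2) (R := fun s' =>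
      ∀ r < d, s'.arr 0 r = (s.arr 0 r + s.int 7 * s.arr 3 r) / T) ?_
    (fun _ h => h) (by omega)
  refine Reach.step rfl <| Reach.step rfl <|
    (Reach.cons (N := d * (8 + 1) + 1) (N' := 1) (R := fun s' =>
      ∀ r < d, s'.arr 0 r = (s.arr 0 r + s.int 7 * s.arr 3 r) / T) ?_
      fun s' h _ => Reach.nil h)
  refine (Reach.loop_frame (R := fun k s' => s'.int 9 = k ∧ ∀ r, s'.arr 0 r =
    if r < k then (s.arr 0 r + s.int 7 * s.arr 3 r) / T else s.arr 0 r)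
    (N := d) (K := 8) (by simpa using hs.cols) (by simp) ?_).mono
    (fun s' h r hr => by rw [h.2, if_pos hr]) le_rfl
  intro k hk s' ⟨h9, h0⟩ ha
  have h3 : s'.int 3 = 1 := (ha.int 3 (by decide)).trans (by simpa using hs.one)
  have e6 : s'.real 6 = s.int 7 := (ha.real 6 (by decide)).trans (by simp)
  have e12 : s'.real 12 = T := (ha.real 12 (by decide)).trans (by simpa using hs.iters)
  have hx : s'.arr 3 = s.arr 3 := (ha.arr 3 (by decide)).trans (by simp)
  refine Reach.step rfl <| Reach.step rfl <| Reach.step rfl <| Reach.step rfl <|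
    Reach.step rfl <| Reach.step rfl <| Reach.step rfl <| Reach.nil ⟨?_, ?_⟩
  · simp [h9, h3]
  · intro r
    simp only [RealOp.eval, RAMStore.int_setReal, RAMStore.int_setArr,
      RAMStore.real_setReal, RAMStore.arr_setInt, RAMStore.arr_setReal, RAMStore.arr_setArr,
      Nat.reduceEqDiff, if_true, if_false, h9, e6, e12, hx]
    exact ite_lt_succ h0 (by rw [h0, if_neg (lt_irrefl k)]) r

end MEBProgram

/-! ### Correctness and cost of the setup. -/

namespace MEBProgram

open RAMProgram

variable {n d T L : ℕ} {η α : ℝ}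

theorem reach_intCeil {I : RAMInput} {s : RAMStore} {r a k : ℕ} {R : RAMStore → Prop}
    (hk : ⌈s.real a⌉₊ = k) (hR : R (s.setInt r k)) :
    Reach I (intCeil r a) s R ((1 + k : ℕ) : ℝ≥0∞) := by
  subst hk
  exact Reach.of_exec rfl hR

theorem reach_setParams (A : Fin n → EuclideanSpace ℝ (Fin d)) (ε : ℝ) :
    Reach (mebInput A ε) setParams RAMStore.init (fun s' =>
      s'.int 0 = n ∧ s'.int 1 = d ∧ s'.int 3 = 1 ∧ s'.int 2 = mebIterations 40000 n ε ∧
      s'.real 0 = mebEta n (mebIterations 40000 n ε) ∧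
      s'.real 1 = mebAlpha n (mebIterations 40000 n ε) ∧
      s'.real 2 = 1 / mebEta n (mebIterations 40000 n ε) ∧
      s'.real 3 = -(1 / mebEta n (mebIterations 40000 n ε)) ∧
      s'.real 12 = mebIterations 40000 n ε ∧ s'.real 14 = -2 ∧ s'.real 15 = 1)
      ((mebIterations 40000 n ε + 23 : ℕ) : ℝ≥0∞) := by
  have hT : ⌈(40000 : ℝ) * Real.log n / (ε * ε)⌉₊ = mebIterations 40000 n ε := by
    rw [mebIterations, sq]
  set T := mebIterations 40000 n ε
  refine Reach.mono_nat (N := (1 + T) + 12 + 10) (R := fun s' =>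
      s'.int 0 = n ∧ s'.int 1 = d ∧ s'.int 3 = 1 ∧ s'.int 2 = T ∧
      s'.real 0 = mebEta n T ∧
      s'.real 1 = mebAlpha n T ∧
      s'.real 2 = 1 / mebEta n T ∧
      s'.real 3 = -(1 / mebEta n T) ∧
      s'.real 12 = T ∧ s'.real 14 = -2 ∧ s'.real 15 = 1) ?_ (fun _ h => h) (by omega)
  refine Reach.step rfl <| Reach.step rfl <| Reach.step rfl <| Reach.step rfl <|
    Reach.step rfl <| Reach.step rfl <| Reach.step rfl <| Reach.step rfl <|
    Reach.step rfl <| Reach.step rfl <| Reach.cons (N := 1 + T) (N' := 12)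
      (R := fun s' => s'.int 0 = n ∧ s'.int 1 = d ∧ s'.int 3 = 1 ∧ s'.int 2 = T ∧
        s'.real 5 = Real.log n) ?_ ?_
  · refine reach_intCeil ?_ ?_
    · simpa [RealOp.eval, mebInput] using hT
    · simp [RealOp.eval, mebInput]
  rintro s ⟨h0, h1, h3, h2, e5⟩ ha
  have e13 : s.real 13 = 0 := (ha.real 13 (by decide)).trans (by simp [RAMStore.init])
  refine Reach.step rfl <| Reach.step rfl <| Reach.step rfl <| Reach.step rfl <|
    Reach.step rfl <| Reach.step rfl <| Reach.step rfl <| Reach.step rfl <|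
    Reach.step rfl <| Reach.step rfl <| Reach.step rfl <| Reach.nil ?_
  simp [RealOp.eval, h0, h1, h2, h3, e5, e13, mebEta, mebAlpha]

theorem reach_setWeights {I : RAMInput} {s : RAMStore} (h0 : s.int 0 = n) (h3 : s.int 3 = 1)
    (e15 : s.real 15 = 1) :
    Reach I setWeights s (fun s' => ∀ r < n, s'.arr 1 r = 1) ((4 * n + 3 : ℕ) : ℝ≥0∞) := by
  refine Reach.mono_nat (N := n * (3 + 1) + 1 + 1 + 1) (R := fun s' => ∀ r < n, s'.arr 1 r = 1) ?_
    (fun _ h => h) (by omega)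
  refine Reach.step rfl <| (Reach.cons (N := n * (3 + 1) + 1) (N' := 1)
    (R := fun s' => ∀ r < n, s'.arr 1 r = 1) ?_ fun s' h _ => Reach.nil h)
  refine (Reach.loop_frame (R := fun k s' => s'.int 9 = k ∧ ∀ r < k, s'.arr 1 r = 1)
    (N := n) (K := 3) (by simpa using h0) (by simp) ?_).mono (fun s' h => h.2) le_rfl
  intro k hk s' ⟨h9, h1⟩ ha
  have h3 : s'.int 3 = 1 := (ha.int 3 (by decide)).trans (by simpa using h3)
  have e15 : s'.real 15 = 1 := (ha.real 15 (by decide)).trans (by simpa using e15)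
  refine Reach.step rfl <| Reach.step rfl <| Reach.nil ⟨by simp [h9, h3], fun r hr => ?_⟩
  rcases eq_or_ne r k with h | h
  · simp [h9, h, e15]
  · simp [h9, h, h1 r (by omega)]

theorem reach_setDepth {I : RAMInput} [NeZero d] {s : RAMStore} (h1 : s.int 1 = d)
    (h3 : s.int 3 = 1) (h5 : s.int 5 = 0) :
    Reach I setDepth s (fun s' => ∃ L, s'.int 5 = L ∧ s'.int 4 = 2 ^ L ∧ 2 ^ L ≤ 2 * d ∧ d ≤ 2 ^ L)
      ((5 * d + 3 : ℕ) : ℝ≥0∞) := by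
  have hd : 0 < d := NeZero.pos d
  refine Reach.mono_nat (N := d * (4 + 1) + 1 + 1 + 1)
    (R := fun s' => ∃ L, s'.int 5 = L ∧ s'.int 4 = 2 ^ L ∧ 2 ^ L ≤ 2 * d ∧ d ≤ 2 ^ L) ?_
    (fun _ h => h) (by omega)
  refine Reach.step rfl <| (Reach.cons (N := d * (4 + 1) + 1) (N' := 1)
    (R := fun s' => ∃ L, s'.int 5 = L ∧ s'.int 4 = 2 ^ L ∧ 2 ^ L ≤ 2 * d ∧ d ≤ 2 ^ L) ?_
    fun s' h _ => Reach.nil h)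
  -- Until the capacity reaches `d` it doubles and so outruns the round counter, hence `d` rounds
  -- suffice. It doubles only below `d`, hence stays at most `2 * d`.
  refine (Reach.loop_frame (R := fun k s' => ∃ L, s'.int 5 = L ∧ s'.int 4 = 2 ^ L ∧ 2 ^ L ≤ 2 * d ∧
    (d ≤ 2 ^ L ∨ k < 2 ^ L)) (N := d) (K := 4) (by simpa using h1)
    ⟨0, by simp [h5], by simp, by omega, by simp⟩ ?_).mono
    (fun s' ⟨L, e1, e2, e3, e4⟩ => ⟨L, e1, e2, e3, by omega⟩) le_rfl
  rintro k hk s' ⟨L, e5, e4, hle, hor⟩ ha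
  have h3 : s'.int 3 = 1 := (ha.int 3 (by decide)).trans (by simpa using h3)
  have h1 : s'.int 1 = d := (ha.int 1 (by decide)).trans (by simpa using h1)
  have hp : 2 ^ (L + 1) = 2 ^ L + 2 ^ L := by ring
  refine Reach.ifIntLt_nat (fun h => ?_) fun h => ?_
  · rw [e4, h1] at h
    refine Reach.step rfl <| Reach.step rfl <| Reach.nil ⟨L + 1, ?_⟩
    simp only [RAMStore.int_setInt, Nat.reduceEqDiff, if_true, if_false, e5, e4, h3, hp, true_and]
    omega
  · rw [e4, h1] at h
    exact Reach.mono_nat (Reach.one (R := fun s' => ∃ L, s'.int 5 = L ∧ s'.int 4 = 2 ^ L ∧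
      2 ^ L ≤ 2 * d ∧ (d ≤ 2 ^ L ∨ k + 1 < 2 ^ L)) rfl ⟨L, e5, e4, hle, Or.inl h⟩)
      (fun _ h => h) (by norm_num)

theorem reach_setup [NeZero d] (A : Fin n → EuclideanSpace ℝ (Fin d)) (ε : ℝ) :
    Reach (mebInput A ε) setup RAMStore.init (fun s' =>
      s'.int 2 = mebIterations 40000 n ε ∧ (∀ r < n, s'.arr 1 r = 1) ∧
      ∃ L, 2 ^ L ≤ 2 * d ∧ d ≤ 2 ^ L ∧
        Consts n d (mebIterations 40000 n ε) L (mebEta n (mebIterations 40000 n ε))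
          (mebAlpha n (mebIterations 40000 n ε)) s')
      ((mebIterations 40000 n ε + 4 * n + 5 * d + 30 : ℕ) : ℝ≥0∞) := by
  refine Reach.mono_nat (Reach.cons (reach_setParams A ε) fun s
    ⟨h0, h1, h3, h2, e0, e1, e2, e3, e12, e14, e15⟩ a => Reach.cons (reach_setWeights h0 h3 e15)
    fun s' hw a' => Reach.cons (reach_setDepth (d := d) ?_ ?_ ?_)
    fun s'' ⟨L, h5, h4, hL, hL'⟩ a'' => Reach.nil
    ⟨?_, fun r hr => (congrFun (a''.arr 1 (by decide)) r).trans (hw r hr), L, hL, hL', ?_⟩)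
    (fun s h => h) (by omega)
  · exact (a'.int 1 (by decide)).trans h1
  · exact (a'.int 3 (by decide)).trans h3
  · exact (a'.int 5 (by decide)).trans ((a.int 5 (by decide)).trans rfl)
  · exact (a''.int 2 (by decide)).trans ((a'.int 2 (by decide)).trans h2)
  · have b := (a'.mono (li' := [4, 5, 9]) (lr' := []) (la' := [1]) (by decide) (by decide)
      (by decide)).trans (a''.mono (by decide) (by decide) (by decide))
    exact
      { rows := (b.int 0 (by decide)).trans h0
        cols := (b.int 1 (by decide)).trans h1
        one := (b.int 3 (by decide)).trans h3
        cap := h4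
        depth := h5
        zero := (b.int 12 (by decide)).trans ((a.int 12 (by decide)).trans rfl)
        eta := (b.real 0 (by decide)).trans e0
        alpha := (b.real 1 (by decide)).trans e1
        upper := (b.real 2 (by decide)).trans e2
        lower := (b.real 3 (by decide)).trans e3
        iters := (b.real 12 (by decide)).trans e12
        rzero := (b.real 13 (by decide)).trans ((a.real 13 (by decide)).trans rfl)
        negTwo := (b.real 14 (by decide)).trans e14
        rone := (b.real 15 (by decide)).trans e15 }

end MEBProgram

/-! ### The program follows the algorithm: one iteration and the whole run. -/

theorem coin_true_le (q : ℝ) : coin q true ≤ ENNReal.ofReal q := by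
  rw [coin, PMF.ofFintype_apply, cond_true]
  exact ENNReal.coe_le_coe.2 (min_le_right _ _)

/-- The state after an iteration in which the row `i` and the column `j` are drawn and the coin
shows `b`. -/
noncomputable def MEBState.next {n d : ℕ} (A : Fin n → EuclideanSpace ℝ (Fin d)) (η : ℝ)
    (S : MEBState n d) (i : Fin n) (j : Fin d) (b : Bool) : MEBState n d where
  w := fun r =>
    S.w r * (1 + η * mebEstimate A η S.x j r + η ^ 2 * mebEstimate A η S.x j r ^ 2)
  y := if b then S.y + A i else S.y
  updates := if b then S.updates + 1 else S.updates
  x := if b then ((S.updates + 1 : ℕ) : ℝ)⁻¹ • (S.y + A i) else S.x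
  total := S.total + S.x

/-- The column is drawn from the old point, so it is independent of the coin and the two choices
commute. The program needs the coin last, because moving the point destroys the old one. -/
theorem mebStep_eq {n d : ℕ} [NeZero n] [NeZero d] (A : Fin n → EuclideanSpace ℝ (Fin d))
    (η α : ℝ) (S : MEBState n d) :
    mebStep A η α S = (sampleWeights S.w).bind fun i => (sampleWeights fun j => S.x j ^ 2).bind
      fun j => (coin α).bind fun b => PMF.pure (S.next A η i j b) := by
  unfold mebStep
  congr 1
  funext i
  rw [PMF.bind_comm]
  congr 1

theorem one_add_add_sq_pos (z : ℝ) : 0 < 1 + z + z ^ 2 := by nlinarith [sq_nonneg (z + 1 / 2)]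

theorem MEBState.next_w_pos {n d : ℕ} {A : Fin n → EuclideanSpace ℝ (Fin d)} {η : ℝ}
    {S : MEBState n d} {r : Fin n} (h : 0 < S.w r) (i : Fin n) (j : Fin d) (b : Bool) :
    0 < (S.next A η i j b).w r := by
  simp only [MEBState.next, ← mul_pow]
  exact mul_pos h (one_add_add_sq_pos _)

namespace MEBProgram

open RAMProgram

variable {n d T L : ℕ} {η α ε : ℝ} {A : Fin n → EuclideanSpace ℝ (Fin d)}

/-- The store represents the state `S`. The total is represented without the summands that have
accumulated since the last change of the primal point. -/
structure Represents (L : ℕ) (s : RAMStore) (S : MEBState n d) : Prop where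
  w : ∀ r : Fin n, s.arr 1 r = S.w r
  w_pos : ∀ r, 0 < S.w r
  y : ∀ j : Fin d, s.arr 2 j = S.y j
  updates : s.int 6 = S.updates
  x : ∀ j : Fin d, s.arr 3 j = S.x j
  total : ∀ j : Fin d, s.arr 0 j + s.int 7 * s.arr 3 j = S.total j
  normSq : s.real 4 = ‖S.x‖ ^ 2
  tree : IsTree d L s

theorem IsTree.of_arr {s s' : RAMStore} (h : IsTree d L s) (h3 : s'.arr 3 = s.arr 3)
    (h4 : s'.arr 4 = s.arr 4) : IsTree d L s' := by
  constructor
  · rw [h4]; exact h.add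
  · rw [h3, h4]; exact h.leaf
  · rw [h4]; exact h.pad

theorem mebInput_entry (i : Fin n) (j : Fin d) : (mebInput A ε).entry i j = A i j := by
  simp [mebInput]

theorem mebInput_rowNorm (i : Fin n) : (mebInput A ε).rowNorm i = ‖A i‖ := by
  simp [mebInput]

theorem weightFactor_eq {s : RAMStore} {S : MEBState n d} (hs : Represents L s S) {j : Fin d}
    (hj : s.int 10 = j ∨ ∀ j : Fin d, s.arr 3 j = 0) (r : Fin n) :
    weightFactor (mebInput A ε) η s r =
      1 + η * mebEstimate A η S.x j r + η ^ 2 * mebEstimate A η S.x j r ^ 2 := by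
  rcases hj with hj | hj
  · simp only [weightFactor, mebEstimate, hj, mebInput_entry, mebInput_rowNorm, hs.normSq, hs.x]
  -- At the zero point the column enters only through a term with the factor `‖S.x‖ ^ 2 = 0`, so
  -- every column gives the same factor.
  · have h0 : S.x = 0 := by
      ext j
      rw [← hs.x, hj]
      rfl
    simp [weightFactor, mebEstimate, mebInput_rowNorm, hs.normSq, h0]

theorem reach_move {s : RAMStore} {S : MEBState n d} (hc : Consts n d T L η α s)
    (hs : Represents L s S) {i : Fin n} (hi : s.int 8 = i) :
    Reach (mebInput A ε) (block [movePoint, buildTree]) s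
      (fun s' => Consts n d T L η α s' ∧ Represents L s' { S with
        y := S.y + A i
        updates := S.updates + 1
        x := ((S.updates + 1 : ℕ) : ℝ)⁻¹ • (S.y + A i) })
      ((18 * d + 9 * 2 ^ L + 13 : ℕ) : ℝ≥0∞) := by
  refine Reach.mono_nat (Reach.cons (reach_movePoint hc) fun s₁ ⟨h6, h7, e4, ht, hy, hx, hl, hr⟩ a₁ =>
    Reach.cons (reach_buildTree (hc.of_agree a₁ (by decide) (by decide))) fun s₂ ⟨hl', hadd⟩ a₂ =>
    Reach.nil ⟨(hc.of_agree a₁ (by decide) (by decide)).of_agree a₂ (by decide) (by decide), ?_⟩)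
    (fun _ h => h) (by omega)
  have hx' : ∀ j : Fin d, s₂.arr 3 j = (((S.updates + 1 : ℕ) : ℝ)⁻¹ • (S.y + A i)) j := by
    intro j
    rw [a₂.arr 3 (by decide), hx j j.2, hi, mebInput_entry, hs.y, hs.updates, div_eq_inv_mul]
    rfl
  refine ⟨fun r => ?_, hs.w_pos, fun j => ?_, ?_, hx', fun j => ?_, ?_, ⟨hadd, ?_, ?_⟩⟩
  · rw [a₂.arr 1 (by decide), a₁.arr 1 (by decide), hs.w]
  · rw [a₂.arr 2 (by decide), hy j j.2, hi, mebInput_entry, hs.y]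
    rfl
  · rw [a₂.int 6 (by decide), h6, hs.updates]
  -- The pending count is now zero, so the stored total is the true one, whatever the new point is.
  · rw [a₂.arr 0 (by decide), ht j j.2, a₂.int 7 (by decide), h7, hs.total]
    simp
  · rw [a₂.real 4 (by decide), e4, ← a₂.arr 3 (by decide), EuclideanSpace.real_norm_sq_eq,
      ← Fin.sum_univ_eq_sum_range (fun r => s₂.arr 3 r ^ 2)]
    exact Finset.sum_congr rfl fun j _ => by rw [hx' j]
  · intro k hk
    rw [hl' _ (by omega), hl k hk, a₂.arr 3 (by decide)]
  · intro k hk hk'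
    rw [hl' _ (by omega), hr _ (by omega), hs.tree.pad k hk hk']

/-- Without a move the represented total still grows by the current point, merely through the
pending counter; all work linear in `d` sits behind the coin. -/
theorem sim_iteration [NeZero n] [NeZero d] (hd : d ≤ 2 ^ L) {s : RAMStore} {S : MEBState n d}
    (hc : Consts n d T L η α s) (hs : Represents L s S) :
    Sim (mebInput A ε) iteration s (mebStep A η α S)
      (fun s' S' => Consts n d T L η α s' ∧ Represents L s' S')
      ((30 * n + 8 * L + 17 : ℕ) + ENNReal.ofReal α * (18 * d + 9 * 2 ^ L + 13 : ℕ)) := by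
  rw [mebStep_eq]
  have hw : (fun i : Fin n => s.arr 1 i) = S.w := funext hs.w
  have hrow := sim_sampleRow (I := mebInput A ε) hc
    (fun r hr => by rw [hs.w ⟨r, hr⟩]; exact hs.w_pos _)
  rw [hw] at hrow
  refine (hrow.frame.seq (N' := ((8 * L + 22 * n + 12 : ℕ) : ℝ≥0∞) +
    ENNReal.ofReal α * (18 * d + 9 * 2 ^ L + 13 : ℕ)) fun s₁ i ⟨h8, a₁⟩ => ?_).mono
    (fun _ _ h => h) (le_of_eq (by push_cast; ring))
  have hc₁ := hc.of_agree a₁ (by decide) (by decide)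
  have ht₁ := hs.tree.of_arr (a₁.arr 3 (by decide)) (a₁.arr 4 (by decide))
  have hcol := sim_sampleCol (I := mebInput A ε) hc₁ hd ht₁
  have hx : (fun j : Fin d => s₁.arr 3 j ^ 2) = fun j => S.x j ^ 2 := by
    funext j
    rw [a₁.arr 3 (by decide), hs.x]
  rw [hx] at hcol
  refine (hcol.frame.seq (N' := ((22 * n + 8 : ℕ) : ℝ≥0∞) +
    ENNReal.ofReal α * (18 * d + 9 * 2 ^ L + 13 : ℕ)) fun s₂ j ⟨h10, a₂⟩ => ?_).mono
    (fun _ _ h => h) (le_of_eq (by push_cast; ring))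
  have hc₂ := hc₁.of_agree a₂ (by decide) (by decide)
  have a := (a₁.mono (li' := [8, 9, 10]) (lr' := [5, 6, 7]) (la' := []) (by decide) (by decide)
      (by decide)).trans (a₂.mono (by decide) (by decide) (by decide))
  have hs₂ : Represents L s₂ S := by
    have e0 := a.arr 0 (by decide)
    have e1 := a.arr 1 (by decide)
    have e2 := a.arr 2 (by decide)
    have e3 := a.arr 3 (by decide)
    refine ⟨?_, hs.w_pos, ?_, ?_, ?_, ?_, ?_, ?_⟩
    · rw [e1]; exact hs.w
    · rw [e2]; exact hs.y
    · rw [a.int 6 (by decide)]; exact hs.updates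
    · rw [e3]; exact hs.x
    · rw [e0, e3, a.int 7 (by decide)]; exact hs.total
    · rw [a.real 4 (by decide)]; exact hs.normSq
    · exact hs.tree.of_arr e3 (a.arr 4 (by decide))
  rw [← a₂.arr 3 (by decide)] at h10
  refine ((reach_updateWeights hc₂).frame.seq_sim (N' := (4 : ℕ) +
    ENNReal.ofReal α * (18 * d + 9 * 2 ^ L + 13 : ℕ)) fun s₃ ⟨h1, a₃⟩ => ?_).mono
    (fun _ _ h => h) (le_of_eq (by push_cast; ring))
  have hc₃ := hc₂.of_agree a₃ (by decide) (by decide)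
  refine (Sim.seq_exec (s' := s₃.setInt 7 (s₃.int 7 + s₃.int 3)) (k := 1) rfl (N := (3 : ℕ) +
    ENNReal.ofReal α * (18 * d + 9 * 2 ^ L + 13 : ℕ)) ?_).mono (fun _ _ h => h)
    (le_of_eq (by push_cast; ring))
  set s₄ := s₃.setInt 7 (s₃.int 7 + s₃.int 3)
  have a₄ : Agree [7] [] [] s₃ s₄ := agree_setInt _ _ _ _ _
  have hc₄ := hc₃.of_agree a₄ (by decide) (by decide)
  have h7 : s₄.int 7 = s₂.int 7 + 1 := by
    simp [s₄, hc₃.one, a₃.int 7 (by decide)]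
  have b := (a₃.mono (li' := [7, 9]) (lr' := [5, 6, 7, 8]) (la' := [1]) (by decide) (by decide)
      (by decide)).trans (a₄.mono (by decide) (by decide) (by decide))
  have hs₄ : Represents L s₄ (S.next A η i j false) := by
    have e0 := b.arr 0 (by decide)
    have e1 := a₄.arr 1 (by decide)
    have e2 := b.arr 2 (by decide)
    have e3 := b.arr 3 (by decide)
    refine ⟨fun r => ?_, fun r => MEBState.next_w_pos (hs.w_pos r) i j false, ?_, ?_, ?_,
      fun k => ?_, ?_, ?_⟩
    · rw [e1, h1 r r.2, weightFactor_eq hs₂ h10, hs₂.w]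
      rfl
    · rw [e2]; exact hs₂.y
    · rw [b.int 6 (by decide)]; exact hs₂.updates
    · rw [e3]; exact hs₂.x
    · rw [e0, e3, h7, Nat.cast_add, Nat.cast_one, add_mul, one_mul, ← add_assoc, hs₂.total, hs₂.x]
      rfl
    · rw [b.real 4 (by decide)]; exact hs₂.normSq
    · exact hs₂.tree.of_arr e3 (b.arr 4 (by decide))
  have h8' : s₄.int 8 = i := by
    rw [b.int 8 (by decide), a₂.int 8 (by decide), h8]
  have hflip := Sim.flip (I := mebInput A ε) (s := s₄) (a := 1)
    (h := fun b => PMF.pure (S.next A η i j b))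
    ((reach_move hc₄ hs₄ h8').sim (b := S.next A η i j true)
      (R' := fun s' S' => Consts n d T L η α s' ∧ Represents L s' S') fun _ h => h)
    ((Reach.one (P := skip) (R := fun s' => s' = s₄) rfl rfl).sim
      (b := S.next A η i j false) fun s' h => by rw [h]; exact ⟨hc₄, hs₄⟩)
  rw [hc₄.alpha] at hflip
  refine (hflip.seq_reach (R' := fun s' S' => Consts n d T L η α s' ∧ Represents L s' S')
    fun s' S' h => Reach.nil h).mono (fun _ _ h => h) ?_
  have h1 : coin α false ≤ 1 := PMF.coe_le_one _ _
  calc _ ≤ ENNReal.ofReal α * (18 * d + 9 * 2 ^ L + 13 : ℕ) + 1 * (1 : ℕ) + 1 + (1 : ℕ) := by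
        gcongr
        exact coin_true_le α
    _ = _ := by
        push_cast
        ring

theorem sim_program [NeZero n] [NeZero d] (A : Fin n → EuclideanSpace ℝ (Fin d)) (ε : ℝ) :
    Sim (mebInput A ε) program RAMStore.init (mebOutput 40000 A ε)
      (fun s x => ∀ j : Fin d, s.arr 0 j = x j)
      (mebIterations 40000 n ε * ((30 * n + 8 * Nat.log 2 (2 * d) + 19 : ℕ) +
        ENNReal.ofReal (mebAlpha n (mebIterations 40000 n ε)) * (36 * d + 13 : ℕ)) +
        (4 * n + 14 * d + 36 : ℕ)) := by
  unfold mebOutput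
  simp only
  set T := mebIterations 40000 n ε
  set η := mebEta n T
  set α := mebAlpha n T
  refine ((reach_setup A ε).frame.seq_sim (N' := T * ((30 * n + 8 * Nat.log 2 (2 * d) + 18 : ℕ) +
        ENNReal.ofReal α * (36 * d + 13 : ℕ)) +
        (9 * d + 6 : ℕ)) fun s ⟨⟨h2, hw, L, hL, hL', hc⟩, a⟩ => ?_).mono (fun _ _ h => h)
    (le_of_eq (by push_cast; ring))
  have hlog : L ≤ Nat.log 2 (2 * d) := Nat.le_log_of_pow_le (by norm_num) hL
  have hinit : Represents L s (MEBState.init n d) := by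
    have e0 := a.arr 0 (by decide)
    have e2 := a.arr 2 (by decide)
    have e3 := a.arr 3 (by decide)
    have e4 := a.arr 4 (by decide)
    refine ⟨fun r => hw r r.2, fun _ => one_pos, fun j => ?_, ?_, fun j => ?_, fun j => ?_, ?_,
      ⟨?_, ?_, ?_⟩⟩
    · rw [e2]; rfl
    · rw [a.int 6 (by decide)]; rfl
    · rw [e3]; rfl
    · rw [e0, e3]; simp [RAMStore.init, MEBState.init]
    · rw [a.real 4 (by decide)]; simp [RAMStore.init, MEBState.init]
    · rw [e4]; simp [RAMStore.init]
    · rw [e3, e4]; simp [RAMStore.init]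
    · rw [e4]; simp [RAMStore.init]
  have hloop := Sim.loop (I := mebInput A ε) (P := iteration) (s := s) (a := 2) (N := T)
    (q := mebIterate A η α) (h := fun _ => mebStep A η α)
    (R := fun _ s' S' => Consts n d T L η α s' ∧ Represents L s' S') h2 ⟨hc, hinit⟩ rfl
    (fun _ _ => rfl) fun _ _ s' S' h => sim_iteration hL' h.1 h.2
  rw [← PMF.bind_pure_comp]
  refine (hloop.seq fun s' S h => Sim.seq_reach (Reach.sim (b := (T : ℝ)⁻¹ • S.total)
    (R' := fun s x => ∀ j : Fin d, s.arr 0 j = x j) (reach_finish h.1) fun s'' hs'' j => ?_)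
      fun s'' x h => Reach.nil h).mono (fun _ _ h => h) ?_
  · rw [hs'' j j.2, h.2.total, div_eq_inv_mul]
    rfl
  · calc _ ≤ T * ((30 * n + 8 * Nat.log 2 (2 * d) + 17 : ℕ) +
          ENNReal.ofReal α * (18 * d + 9 * (2 * d) + 13 : ℕ) + 1) + 1 +
          (((9 * d + 4 : ℕ) : ℝ≥0∞) + (1 : ℕ)) := by gcongr
      _ = _ := by
        push_cast
        ring

end MEBProgram

/-! ### The running time -/

theorem half_lt_log_two : 1 / 2 < Real.log 2 := by
  have := Real.log_two_gt_d9
  norm_num at this ⊢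
  linarith

theorem half_lt_log {n : ℕ} (hn : 2 ≤ n) : 1 / 2 < Real.log n :=
  half_lt_log_two.trans_le (Real.log_le_log two_pos (by exact_mod_cast hn))

theorem mebIterations_le {n : ℕ} (hn : 2 ≤ n) {ε : ℝ} (hε : 0 < ε) (h1 : ε ≤ 1) :
    (mebIterations 40000 n ε : ℝ) ≤ 40002 * (Real.log n / ε ^ 2) := by
  have hl := half_lt_log hn
  have hT : (mebIterations 40000 n ε : ℝ) < 40000 * Real.log n / ε ^ 2 + 1 :=
    Nat.ceil_lt_add_one (by positivity)
  have h : 1 ≤ 2 * (Real.log n / ε ^ 2) := by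
    rw [← mul_div_assoc, one_le_div (by positivity)]
    nlinarith
  rw [mul_div_assoc] at hT
  linarith

theorem log_natLog_le {d : ℕ} (hd : 1 ≤ d) : (Nat.log 2 (2 * d) : ℝ) ≤ 1 + 2 * Real.log d := by
  have h : (2 : ℝ) ^ Nat.log 2 (2 * d) ≤ 2 * d := by
    exact_mod_cast Nat.pow_log_le_self 2 (by omega)
  have hd' : (0 : ℝ) < d := by exact_mod_cast hd
  have h' := Real.log_le_log (by positivity) h
  rw [Real.log_pow, Real.log_mul (by norm_num) hd'.ne'] at h'
  have hl := half_lt_log_two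
  have hld : 0 ≤ Real.log d := Real.log_natCast_nonneg d
  by_contra! hlt
  nlinarith

theorem mebAlpha_nonneg (n T : ℕ) : 0 ≤ mebAlpha n T :=
  div_nonneg (Real.log_natCast_nonneg T) (Real.sqrt_nonneg _)

/-- The three summands are bounded separately: the work per iteration in `n` and `log d`, the
expected work of the moves, and setup plus finish. -/
theorem runningTime_le {n d : ℕ} (hn : 2 ≤ n) (hd : 1 ≤ d) {ε : ℝ} (hε : 0 < ε) (h1 : ε ≤ 1) :
    (mebIterations 40000 n ε : ℝ) * ((30 * n + 8 * Nat.log 2 (2 * d) + 19) +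
      mebAlpha n (mebIterations 40000 n ε) * (36 * d + 13)) + (4 * n + 14 * d + 36) ≤
    10 ^ 10 * (n / ε ^ 2 + d / ε) * Real.log (n * d / ε) ^ 2 := by
  have hl := half_lt_log hn
  have hn' : (2 : ℝ) ≤ n := by exact_mod_cast hn
  have hd' : (1 : ℝ) ≤ d := by exact_mod_cast hd
  have hld : 0 ≤ Real.log d := Real.log_natCast_nonneg d
  have hle : 0 ≤ -Real.log ε := by
    rw [neg_nonneg]
    exact Real.log_nonpos hε.le h1
  set Λ := Real.log (n * d / ε) with hΛ
  have hΛe : Λ = Real.log n + Real.log d - Real.log ε := by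
    rw [hΛ, Real.log_div (by positivity) hε.ne', Real.log_mul (by positivity) (by positivity)]
  have hTle := mebIterations_le hn hε h1
  set T := mebIterations 40000 n ε with hT
  have hT1 : (0 : ℝ) < T := by
    rw [hT, mebIterations]
    exact_mod_cast Nat.ceil_pos.2 (by positivity)
  have hlog := log_natLog_le hd
  -- Since `Λ ≥ log n > 1 / 2`, additive constants can be absorbed into multiples of `Λ`.
  have hΛ1 : 1 ≤ 2 * Λ := by linarith
  have hΛ0 : 0 < Λ := by linarith
  have e2 : 0 < ε ^ 2 := by positivity
  set X := (n : ℝ) / ε ^ 2 with hX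
  set Y := (d : ℝ) / ε with hY
  have hnX : (n : ℝ) ≤ X := by
    rw [hX, le_div_iff₀ e2]
    exact mul_le_of_le_one_right (by positivity) (pow_le_one₀ hε.le h1)
  have hdY : (d : ℝ) ≤ Y := by
    rw [hY, le_div_iff₀ hε]
    nlinarith
  have hTn : (T : ℝ) * n ≤ 40002 * Λ * X := by
    calc (T : ℝ) * n ≤ 40002 * (Real.log n / ε ^ 2) * n := by gcongr
      _ = 40002 * Real.log n * X := by rw [hX]; ring
      _ ≤ 40002 * Λ * X := by gcongr; linarith
  have hterm1 : (T : ℝ) * (30 * n + 8 * Nat.log 2 (2 * d) + 19) ≤ 40002 * 96 * (Λ ^ 2 * X) := by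
    have : (30 * n + 8 * Nat.log 2 (2 * d) + 19 : ℝ) ≤ n * (96 * Λ) := by nlinarith
    calc (T : ℝ) * (30 * n + 8 * Nat.log 2 (2 * d) + 19) ≤ T * (n * (96 * Λ)) := by gcongr
      _ = T * n * (96 * Λ) := by ring
      _ ≤ 40002 * Λ * X * (96 * Λ) := by gcongr
      _ = _ := by ring
  have hlogT : Real.log T ≤ 80006 * Λ := by
    have hb : (T : ℝ) ≤ 40002 * (n / ε) ^ 2 := by
      refine hTle.trans ?_
      rw [div_pow]
      gcongr
      have := Real.log_le_sub_one_of_pos (show (0 : ℝ) < n by positivity)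
      nlinarith
    have := Real.log_le_log hT1 hb
    rw [Real.log_mul (by norm_num) (by positivity), Real.log_pow,
      Real.log_div (by positivity) hε.ne'] at this
    have h4 := Real.log_le_sub_one_of_pos (show (0 : ℝ) < 40002 by norm_num)
    push_cast at this
    linarith
  have hTα : (T : ℝ) * mebAlpha n T ≤ 80006 * Λ * (201 / ε) := by
    have hs : 0 < Real.sqrt (T * Real.log n) := Real.sqrt_pos.2 (by positivity)
    -- The square of the left side is `T / log n ≤ 40002 / ε ^ 2`, and `40002 < 201 ^ 2`.
    have : T / Real.sqrt (T * Real.log n) ≤ 201 / ε := by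
      rw [div_le_div_iff₀ hs hε]
      refine le_of_sq_le_sq ?_ (by positivity)
      rw [mul_pow, mul_pow, Real.sq_sqrt (by positivity)]
      have : (T : ℝ) * ε ^ 2 ≤ 40002 * Real.log n := by
        rw [← le_div_iff₀ e2, mul_div_assoc]
        exact hTle
      nlinarith
    calc (T : ℝ) * mebAlpha n T = Real.log T * (T / Real.sqrt (T * Real.log n)) := by
          rw [mebAlpha]; ring
      _ ≤ 80006 * Λ * (201 / ε) := by gcongr
  have hterm2 : (T : ℝ) * (mebAlpha n T * (36 * d + 13)) ≤ 80006 * 201 * 49 * 2 * (Λ ^ 2 * Y) := by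
    calc (T : ℝ) * (mebAlpha n T * (36 * d + 13)) = T * mebAlpha n T * (36 * d + 13) := by ring
      _ ≤ 80006 * Λ * (201 / ε) * (49 * d) :=
        mul_le_mul hTα (by linarith) (by positivity) (by positivity)
      _ = 80006 * 201 * 49 * (Λ * Y) := by rw [hY]; ring
      _ ≤ 80006 * 201 * 49 * (2 * Λ * Λ * Y) := by
        gcongr
        nlinarith
      _ = _ := by ring
  have hL2 : 1 ≤ 4 * Λ ^ 2 := by nlinarith
  have hterm3 : (4 * n + 14 * d + 36 : ℝ) ≤ 16 * (Λ ^ 2 * X) + 200 * (Λ ^ 2 * Y) := by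
    have hX0 : 0 ≤ X := by positivity
    have hY0 : 0 ≤ Y := by positivity
    nlinarith [mul_le_mul_of_nonneg_right hL2 hX0, mul_le_mul_of_nonneg_right hL2 hY0]
  have hpX : 0 ≤ Λ ^ 2 * X := by positivity
  have hpY : 0 ≤ Λ ^ 2 * Y := by positivity
  rw [mul_add]
  have : (10 : ℝ) ^ 10 * (X + Y) * Λ ^ 2 = 10 ^ 10 * (Λ ^ 2 * X) + 10 ^ 10 * (Λ ^ 2 * Y) := by ring
  rw [this]
  linarith

theorem expectedTime_program_le {n d : ℕ} [NeZero n] [NeZero d]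
    (A : Fin n → EuclideanSpace ℝ (Fin d)) {ε : ℝ} (hn : 2 ≤ n) (hε : 0 < ε) (h1 : ε ≤ 1) :
    MEBProgram.program.expectedTime (mebInput A ε) ≤
      ENNReal.ofReal (10 ^ 10 * (n / ε ^ 2 + d / ε) * Real.log (n * d / ε) ^ 2) := by
  refine (MEBProgram.sim_program A ε).expectedTime_le.trans ?_
  refine le_trans (le_of_eq ?_) (ENNReal.ofReal_le_ofReal
    (runningTime_le hn (Nat.one_le_iff_ne_zero.2 (NeZero.ne d)) hε h1))
  have hα := mebAlpha_nonneg n (mebIterations 40000 n ε)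
  rw [ENNReal.ofReal_add (by positivity) (by positivity), ENNReal.ofReal_mul (by positivity),
    ENNReal.ofReal_add (by positivity) (by positivity), ENNReal.ofReal_mul hα,
    ENNReal.ofReal_natCast]
  congr 2
  · congr 1
    · rw [← ENNReal.ofReal_natCast]; push_cast; rfl
    · congr 1
      rw [← ENNReal.ofReal_natCast]; push_cast; rfl
  · rw [← ENNReal.ofReal_natCast]; push_cast; rfl

/-! ### Expectations of real functions over finite types -/

namespace PMF

variable {α : Type*} [Fintype α]

/-- The expectation of a real function over a finite type. -/
noncomputable def expect (p : PMF α) (f : α → ℝ) : ℝ := ∑ a, (p a).toReal * f a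

theorem sum_toReal (p : PMF α) : ∑ a, (p a).toReal = 1 := by
  rw [← ENNReal.toReal_sum fun a _ => p.apply_ne_top a, ← tsum_fintype (L := .unconditional α),
    p.tsum_coe, ENNReal.toReal_one]

theorem expect_const (p : PMF α) (b : ℝ) : p.expect (fun _ => b) = b := by
  rw [expect, ← Finset.sum_mul, sum_toReal, one_mul]

theorem expect_add (p : PMF α) (f g : α → ℝ) :
    p.expect (fun a => f a + g a) = p.expect f + p.expect g := by
  simp only [expect, mul_add, Finset.sum_add_distrib]

theorem expect_sub (p : PMF α) (f g : α → ℝ) :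
    p.expect (fun a => f a - g a) = p.expect f - p.expect g := by
  simp only [expect, mul_sub, Finset.sum_sub_distrib]

theorem expect_mul_left (p : PMF α) (b : ℝ) (f : α → ℝ) :
    p.expect (fun a => b * f a) = b * p.expect f := by
  simp only [expect, Finset.mul_sum, mul_left_comm]

theorem expect_sum {ι : Type*} (p : PMF α) (s : Finset ι) (f : ι → α → ℝ) :
    p.expect (fun a => ∑ i ∈ s, f i a) = ∑ i ∈ s, p.expect (f i) := by
  simp only [expect, Finset.mul_sum]
  exact Finset.sum_comm

theorem expect_mono (p : PMF α) {f g : α → ℝ} (h : ∀ a, f a ≤ g a) : p.expect f ≤ p.expect g :=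
  Finset.sum_le_sum fun a _ => mul_le_mul_of_nonneg_left (h a) ENNReal.toReal_nonneg

theorem expect_nonneg (p : PMF α) {f : α → ℝ} (h : ∀ a, 0 ≤ f a) : 0 ≤ p.expect f :=
  Finset.sum_nonneg fun a _ => mul_nonneg ENNReal.toReal_nonneg (h a)

theorem mean_ofReal (p : PMF α) {f : α → ℝ} (h : ∀ a, 0 ≤ f a) :
    p.mean (fun a => ENNReal.ofReal (f a)) = ENNReal.ofReal (p.expect f) := by
  rw [mean_fintype, expect, ENNReal.ofReal_sum_of_nonneg
    fun a _ => mul_nonneg ENNReal.toReal_nonneg (h a)]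
  refine Finset.sum_congr rfl fun a _ => ?_
  rw [ENNReal.ofReal_mul ENNReal.toReal_nonneg, ENNReal.ofReal_toReal (p.apply_ne_top a)]

end PMF

/-! ### The estimates of the squared distances -/

/-- Clipping acts only where `|z| ≥ 1 / η`, and there the change is at most `|z| ≤ η * z ^ 2`. The
bias of the estimate is thus `η` times a second moment. -/
theorem abs_clip_sub_le {z η : ℝ} (hη : 0 < η) : |clip z (1 / η) - z| ≤ η * z ^ 2 := by
  have hV : 0 < 1 / η := by positivity
  have h1 : η * (1 / η) = 1 := by field_simp
  rw [clip]
  rcases le_total z (-(1 / η)) with h | h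
  · rw [max_eq_left h, min_eq_right (by linarith), abs_of_nonneg (by linarith)]
    nlinarith
  · rw [max_eq_right h]
    rcases le_total (1 / η) z with h' | h'
    · rw [min_eq_left h', abs_of_nonpos (by linarith)]
      nlinarith
    · rw [min_eq_right h', sub_self, abs_zero]
      positivity

theorem clip_sq_le {z V : ℝ} (hV : 0 ≤ V) : clip z V ^ 2 ≤ z ^ 2 := by
  rw [clip]
  rcases le_total z (-V) with h | h
  · rw [max_eq_left h, min_eq_right (by linarith)]
    nlinarith
  · rw [max_eq_right h]
    rcases le_total V z with h' | h'
    · rw [min_eq_left h']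
      nlinarith
    · rw [min_eq_right h']

theorem norm_sub_sq_eq {d : ℕ} (x a : EuclideanSpace ℝ (Fin d)) :
    ‖x - a‖ ^ 2 = -2 * inner ℝ x a + ‖a‖ ^ 2 + ‖x‖ ^ 2 := by
  rw [norm_sub_sq_real]
  ring

section estimate

variable {n d : ℕ} [NeZero d] {A : Fin n → EuclideanSpace ℝ (Fin d)}
  {x : EuclideanSpace ℝ (Fin d)} {η : ℝ} {i : Fin n}

/-- The multiplied form covers `x = 0` too, where the distribution is uniform. -/
theorem toReal_sampleWeights_sq (x : EuclideanSpace ℝ (Fin d)) (j : Fin d) :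
    (sampleWeights (fun j => x j ^ 2) j).toReal * ‖x‖ ^ 2 = x j ^ 2 := by
  rcases eq_or_ne x 0 with rfl | hx
  · simp
  · have hp : 0 < ∑ j, x j ^ 2 := by
      rw [← EuclideanSpace.real_norm_sq_eq]
      positivity
    rw [sampleWeights_apply (fun _ => sq_nonneg _) hp, EuclideanSpace.real_norm_sq_eq,
      ENNReal.toReal_ofReal (by positivity), div_mul_cancel₀ _ hp.ne']

theorem expect_cross (x a : EuclideanSpace ℝ (Fin d)) :
    (sampleWeights fun j => x j ^ 2).expect (fun j => -2 * a j * ‖x‖ ^ 2 / x j) =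
      -2 * inner ℝ x a := by
  rw [expect, PiLp.inner_apply, Finset.mul_sum]
  refine Finset.sum_congr rfl fun j _ => ?_
  have := toReal_sampleWeights_sq x j
  rcases eq_or_ne (x j) 0 with h | h
  · simp [h]
  · simp only [RCLike.inner_apply, conj_trivial]
    field_simp
    linear_combination (-a j) * this

/-- A coordinate with `x j ≠ 0` contributes exactly `4 * ‖x‖ ^ 2 * a j ^ 2`; the others contribute
zero. -/
theorem expect_cross_sq_le (x a : EuclideanSpace ℝ (Fin d)) :
    (sampleWeights fun j => x j ^ 2).expect (fun j => (-2 * a j * ‖x‖ ^ 2 / x j) ^ 2) ≤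
      4 * ‖x‖ ^ 2 * ‖a‖ ^ 2 := by
  rw [expect, EuclideanSpace.real_norm_sq_eq a, Finset.mul_sum]
  refine Finset.sum_le_sum fun j _ => ?_
  have := toReal_sampleWeights_sq x j
  rcases eq_or_ne (x j) 0 with h | h
  · simp only [h, div_zero]
    norm_num
    positivity
  · refine le_of_eq ?_
    field_simp
    linear_combination (4 * a j ^ 2 * ‖x‖ ^ 2) * this

theorem expect_raw_sq_le (hA : ‖A i‖ ≤ 1) (hx : ‖x‖ ≤ 1) :
    (sampleWeights fun j => x j ^ 2).expect
      (fun j => (-2 * A i j * ‖x‖ ^ 2 / x j + ‖A i‖ ^ 2 + ‖x‖ ^ 2) ^ 2) ≤ 16 := by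
  have h1 : ‖A i‖ ^ 2 ≤ 1 := pow_le_one₀ (norm_nonneg _) hA
  have h2 : ‖x‖ ^ 2 ≤ 1 := pow_le_one₀ (norm_nonneg _) hx
  have h3 := expect_cross_sq_le x (A i)
  calc _ ≤ (sampleWeights fun j => x j ^ 2).expect
        -- By `(u + v) ^ 2 ≤ 2 u ^ 2 + 2 v ^ 2` with `v = ‖A i‖ ^ 2 + ‖x‖ ^ 2 ≤ 2`; the first part
        -- then averages to at most `8`.
        (fun j => 2 * (-2 * A i j * ‖x‖ ^ 2 / x j) ^ 2 + 8) := by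
        refine expect_mono _ fun j => ?_
        set u := -2 * A i j * ‖x‖ ^ 2 / x j
        nlinarith [sq_nonneg (u - (‖A i‖ ^ 2 + ‖x‖ ^ 2)), sq_nonneg ‖A i‖, sq_nonneg ‖x‖]
    _ ≤ 16 := by
        rw [expect_add, expect_const, expect_mul_left]
        nlinarith [sq_nonneg ‖A i‖, sq_nonneg ‖x‖]

theorem expect_estimate_sq_le (hη : 0 < η) (hA : ‖A i‖ ≤ 1) (hx : ‖x‖ ≤ 1) :
    (sampleWeights fun j => x j ^ 2).expect (fun j => mebEstimate A η x j i ^ 2) ≤ 16 :=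
  (expect_mono _ fun _ => clip_sq_le (by positivity)).trans (expect_raw_sq_le hA hx)

theorem abs_expect_estimate_sub_le (hη : 0 < η) (hA : ‖A i‖ ≤ 1) (hx : ‖x‖ ≤ 1) :
    |(sampleWeights fun j => x j ^ 2).expect (fun j => mebEstimate A η x j i) - ‖x - A i‖ ^ 2| ≤
      16 * η := by
  have e : ‖x - A i‖ ^ 2 = (sampleWeights fun j => x j ^ 2).expect
      (fun j => -2 * A i j * ‖x‖ ^ 2 / x j + ‖A i‖ ^ 2 + ‖x‖ ^ 2) := by
    rw [expect_add, expect_add, expect_const, expect_const, expect_cross, norm_sub_sq_eq]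
  have h := expect_raw_sq_le hA hx
  have hb : ∀ j, |mebEstimate A η x j i - (-2 * A i j * ‖x‖ ^ 2 / x j + ‖A i‖ ^ 2 + ‖x‖ ^ 2)| ≤
    η * (-2 * A i j * ‖x‖ ^ 2 / x j + ‖A i‖ ^ 2 + ‖x‖ ^ 2) ^ 2 := fun j => abs_clip_sub_le hη
  have hη16 : η * (sampleWeights fun j => x j ^ 2).expect
      (fun j => (-2 * A i j * ‖x‖ ^ 2 / x j + ‖A i‖ ^ 2 + ‖x‖ ^ 2) ^ 2) ≤ 16 * η := by nlinarith
  rw [← expect_mul_left] at hη16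
  rw [e, ← expect_sub, abs_le]
  constructor
  · rw [neg_le, ← neg_one_mul, ← expect_mul_left]
    refine (expect_mono _ fun j => ?_).trans hη16
    have := (abs_le.1 (hb j)).1
    linarith
  · exact (expect_mono _ fun j => (abs_le.1 (hb j)).2).trans hη16

end estimate

/-! ### The potential -/

/-- What holds for all states after `t` iterations. -/
structure MEBState.Valid {n d : ℕ} (t : ℕ) (S : MEBState n d) : Prop where
  w_pos : ∀ i, 0 < S.w i
  y_eq : S.y = (S.updates : ℝ) • S.x
  norm_x_le : ‖S.x‖ ≤ 1
  updates_le : S.updates ≤ t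
  norm_total_le : ‖S.total‖ ≤ t

section

variable {n d : ℕ} {A : Fin n → EuclideanSpace ℝ (Fin d)} {η α : ℝ}

theorem MEBState.valid_init : (MEBState.init n d).Valid 0 :=
  ⟨fun _ => one_pos, by simp [init], by simp [init], by simp [init], by simp [init]⟩

theorem MEBState.Valid.next {t : ℕ} {S : MEBState n d} (hS : S.Valid t) (hA : ∀ i, ‖A i‖ ≤ 1)
    (i : Fin n) (j : Fin d) (b : Bool) : (S.next A η i j b).Valid (t + 1) := by
  refine ⟨fun r => next_w_pos (hS.w_pos r) i j b, ?_, ?_, ?_, ?_⟩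
  · cases b
    · exact hS.y_eq
    · have : ((S.updates + 1 : ℕ) : ℝ) ≠ 0 := by positivity
      exact (smul_inv_smul₀ this _).symm
  · cases b
    · exact hS.norm_x_le
    · have hp : (0 : ℝ) < (S.updates + 1 : ℕ) := by positivity
      simp only [MEBState.next, if_true]
      rw [norm_smul, norm_inv, Real.norm_of_nonneg hp.le, inv_mul_le_one₀ hp, hS.y_eq]
      refine (norm_add_le _ _).trans ?_
      rw [norm_smul, Real.norm_natCast, Nat.cast_add, Nat.cast_one]
      exact add_le_add (mul_le_of_le_one_right (by positivity) hS.norm_x_le) (hA i)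
  · have := hS.updates_le
    cases b
    · exact this.trans (Nat.le_succ t)
    · exact Nat.succ_le_succ this
  · rw [Nat.cast_add, Nat.cast_one]
    exact (norm_add_le _ _).trans (add_le_add hS.norm_total_le hS.norm_x_le)

/-- The sum, over the rows, of the exponential of `η` times the accumulated distance (up to a
summand that does not depend on the row), divided by the weight. -/
noncomputable def mebPhi (A : Fin n → EuclideanSpace ℝ (Fin d)) (η : ℝ) (t : ℕ)
    (S : MEBState n d) : ℝ :=
  ∑ i, Real.exp (η * (-2 * inner ℝ S.total (A i) + t * ‖A i‖ ^ 2)) / S.w i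

/-- The potential of follow-the-leader against the fixed point `z`. -/
noncomputable def leaderPotential (z : EuclideanSpace ℝ (Fin d)) (S : MEBState n d) : ℝ :=
  S.updates * ‖z - S.x‖ ^ 2 - 4 * harmonic S.updates

/-- The potential of the algorithm against the fixed point `z`. -/
noncomputable def mebPotential (A : Fin n → EuclideanSpace ℝ (Fin d)) (η α : ℝ)
    (z : EuclideanSpace ℝ (Fin d)) (t : ℕ) (S : MEBState n d) : ℝ :=
  Real.log (∑ i, S.w i) + Real.log (mebPhi A η t S) + η * (‖S.total‖ ^ 2 / t) +
    η / α * leaderPotential z S - η * t * sqRadiusAt A z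

theorem le_sqRadiusAt (A : Fin n → EuclideanSpace ℝ (Fin d)) (x : EuclideanSpace ℝ (Fin d))
    (i : Fin n) : ‖x - A i‖ ^ 2 ≤ sqRadiusAt A x :=
  le_ciSup (f := fun i => ‖x - A i‖ ^ 2) (Set.finite_range _).bddAbove i

theorem norm_sub_sq_le_four {x a : EuclideanSpace ℝ (Fin d)} (hx : ‖x‖ ≤ 1) (ha : ‖a‖ ≤ 1) :
    ‖x - a‖ ^ 2 ≤ 4 := by
  have := norm_sub_le x a
  nlinarith [norm_nonneg (x - a)]

theorem norm_add_sq_div_le {E : Type*} [NormedAddCommGroup E] [InnerProductSpace ℝ E] (a x : E)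
    {t : ℝ} (ht : 0 < t) : ‖a + x‖ ^ 2 / (t + 1) ≤ ‖a‖ ^ 2 / t + ‖x‖ ^ 2 := by
  have h : 0 ≤ ‖a - t • x‖ ^ 2 := by positivity
  rw [norm_sub_sq_real, inner_smul_right, norm_smul, Real.norm_of_nonneg ht.le] at h
  rw [norm_add_sq_real, div_add' _ _ _ ht.ne', div_le_div_iff₀ (by linarith) ht]
  nlinarith

/-- Adding `a` to a mean `x` of `m` points: both sides compare sums of squared distances to `z` with
those to the mean. -/
theorem leader_identity {E : Type*} [NormedAddCommGroup E] [InnerProductSpace ℝ E] (z x a : E)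
    {m : ℝ} (hm : 0 ≤ m) :
    (m + 1) * ‖z - (m + 1)⁻¹ • (m • x + a)‖ ^ 2 =
      m * ‖z - x‖ ^ 2 + ‖z - a‖ ^ 2 - m / (m + 1) * ‖x - a‖ ^ 2 := by
  have hm1 : m + 1 ≠ 0 := by positivity
  have e1 : z - (m + 1)⁻¹ • (m • x + a) = (m + 1)⁻¹ • (m • (z - x) + (z - a)) := by
    rw [eq_inv_smul_iff₀ hm1, smul_sub, smul_inv_smul₀ hm1]
    module
  have e2 : x - a = (z - a) - (z - x) := by abel
  rw [e1, e2, norm_smul, mul_pow, norm_add_sq_real, norm_sub_sq_real (z - a), norm_smul, norm_inv,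
    inner_smul_left, real_inner_comm (z - x) (z - a), Real.norm_of_nonneg hm,
    Real.norm_of_nonneg (by positivity : 0 ≤ m + 1)]
  simp only [conj_trivial]
  field_simp
  ring

/-- In `leader_identity` the factor `m / (m + 1)` falls short of `1` by `1 / (m + 1)`, an error of
at most `4 / (m + 1)`; the harmonic term of the potential pays for it. -/
theorem leaderPotential_update {t : ℕ} {S : MEBState n d} (hS : S.Valid t) (hA : ∀ i, ‖A i‖ ≤ 1)
    (z : EuclideanSpace ℝ (Fin d)) (i : Fin n) (j : Fin d) :
    leaderPotential z (S.next A η i j true) ≤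
      leaderPotential z S + (sqRadiusAt A z - ‖S.x - A i‖ ^ 2) := by
  have h := leader_identity z S.x (A i) (Nat.cast_nonneg (α := ℝ) S.updates)
  have h1 := le_sqRadiusAt A z i
  have h2 := norm_sub_sq_le_four hS.norm_x_le (hA i)
  simp only [leaderPotential, MEBState.next, if_true, harmonic_succ, hS.y_eq]
  push_cast
  rw [h]
  have hm : (0 : ℝ) < S.updates + 1 := by positivity
  have e : (S.updates : ℝ) / (S.updates + 1) = 1 - (S.updates + 1 : ℝ)⁻¹ := by
    field_simp
    ring
  rw [e]
  have : (S.updates + 1 : ℝ)⁻¹ * ‖S.x - A i‖ ^ 2 ≤ (S.updates + 1 : ℝ)⁻¹ * 4 := by gcongr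
  linarith

theorem norm_total_sq_div_le {t : ℕ} {S : MEBState n d} (hS : S.Valid t) :
    ‖S.total + S.x‖ ^ 2 / (t + 1 : ℕ) ≤ ‖S.total‖ ^ 2 / t + ‖S.x‖ ^ 2 := by
  rcases Nat.eq_zero_or_pos t with rfl | ht
  · have : S.total = 0 := norm_le_zero_iff.1 (by simpa using hS.norm_total_le)
    simp [this]
  · rw [Nat.cast_add, Nat.cast_one]
    exact norm_add_sq_div_le _ _ (by exact_mod_cast ht)

theorem mebPotential_init (z : EuclideanSpace ℝ (Fin d)) :
    mebPotential A η α z 0 (MEBState.init n d) = 2 * Real.log n := by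
  simp [mebPotential, MEBState.init, mebPhi, leaderPotential]
  ring

/-- The product of the two quadratics is `1 + z ^ 2 + z ^ 4`. Thus dividing by the weight update, as
`mebPhi` does, costs only a second-order term. -/
theorem inv_one_add_add_sq_le (z : ℝ) : (1 + z + z ^ 2)⁻¹ ≤ 1 - z + z ^ 2 := by
  rw [inv_le_iff_one_le_mul₀ (one_add_add_sq_pos z)]
  nlinarith [sq_nonneg z, sq_nonneg (z ^ 2)]

theorem toReal_sampleWeights [NeZero n] {S : MEBState n d} (hw : ∀ i, 0 < S.w i) (i : Fin n) :
    (sampleWeights S.w i).toReal = S.w i / ∑ k, S.w k := by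
  have hW : 0 < ∑ k, S.w k := Finset.sum_pos (fun i _ => hw i) Finset.univ_nonempty
  rw [sampleWeights_apply (fun i => (hw i).le) hW,
    ENNReal.toReal_ofReal (div_nonneg (hw i).le hW.le)]

/-- By `log u ≤ u - 1`, the growth is at most the `p`-average of `η v + η ^ 2 v ^ 2`. The bias `16
η` and the second moment `16` of the estimate contribute `16 η ^ 2` each. -/
theorem expect_log_weights_le [NeZero n] [NeZero d] {t : ℕ} {S : MEBState n d} (hS : S.Valid t) (hη : 0 < η)
    (hA : ∀ i, ‖A i‖ ≤ 1) (i₀ : Fin n) (b : Bool) :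
    (sampleWeights fun j => S.x j ^ 2).expect
        (fun j => Real.log (∑ i, (S.next A η i₀ j b).w i)) ≤
      Real.log (∑ i, S.w i) + η * (sampleWeights S.w).expect (fun i => ‖S.x - A i‖ ^ 2) +
        32 * η ^ 2 := by
  have hW : 0 < ∑ k, S.w k := Finset.sum_pos (fun i _ => hS.w_pos i) Finset.univ_nonempty
  set q := sampleWeights fun j => S.x j ^ 2
  set p := sampleWeights S.w
  have hj : ∀ j, Real.log (∑ i, (S.next A η i₀ j b).w i) ≤ Real.log (∑ i, S.w i) +
      p.expect (fun i => η * mebEstimate A η S.x j i + η ^ 2 * mebEstimate A η S.x j i ^ 2) := by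
    intro j
    have hW' : 0 < ∑ k, (S.next A η i₀ j b).w k :=
      Finset.sum_pos (fun i _ => MEBState.next_w_pos (hS.w_pos i) _ _ _) Finset.univ_nonempty
    have := Real.log_le_sub_one_of_pos (div_pos hW' hW)
    rw [Real.log_div hW'.ne' hW.ne'] at this
    have e : (∑ k, (S.next A η i₀ j b).w k) / (∑ k, S.w k) - 1 =
        p.expect (fun i => η * mebEstimate A η S.x j i + η ^ 2 * mebEstimate A η S.x j i ^ 2) := by
      rw [div_sub_one hW.ne', ← Finset.sum_sub_distrib, expect, Finset.sum_div]
      refine Finset.sum_congr rfl fun i _ => ?_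
      rw [toReal_sampleWeights hS.w_pos]
      simp only [MEBState.next]
      ring
    linarith
  refine (expect_mono _ hj).trans ?_
  have hswap : q.expect (fun j => p.expect fun i =>
      η * mebEstimate A η S.x j i + η ^ 2 * mebEstimate A η S.x j i ^ 2) =
      p.expect fun i => q.expect fun j =>
        η * mebEstimate A η S.x j i + η ^ 2 * mebEstimate A η S.x j i ^ 2 := by
    simp only [expect, Finset.mul_sum]
    rw [Finset.sum_comm]
    simp only [mul_left_comm]
  rw [expect_add, expect_const, hswap, add_assoc]
  gcongr
  rw [← expect_mul_left, ← expect_const p (32 * η ^ 2), ← expect_add]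
  refine expect_mono _ fun i => ?_
  rw [expect_add, expect_mul_left, expect_mul_left]
  have h1 := (abs_le.1 (abs_expect_estimate_sub_le hη (hA i) hS.norm_x_le)).2
  have h2 := expect_estimate_sq_le hη (hA i) hS.norm_x_le
  nlinarith [sq_nonneg η]

theorem mebPhi_pos [NeZero n] {t : ℕ} {S : MEBState n d} (hS : S.Valid t) (t' : ℕ) : 0 < mebPhi A η t' S :=
  Finset.sum_pos (fun i _ => div_pos (Real.exp_pos _) (hS.w_pos i)) Finset.univ_nonempty

/-- For each row the exponential gains `exp (η (‖x - A i‖ ^ 2 - ‖x‖ ^ 2))`, while the inverse weight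
factor averages to at most `exp (- η ‖x - A i‖ ^ 2 + 32 η ^ 2)`. The distance cancels and a factor
common to all rows remains. -/
theorem expect_mebPhi_le [NeZero d] {t : ℕ} {S : MEBState n d} (hS : S.Valid t) (hη : 0 < η)
    (hA : ∀ i, ‖A i‖ ≤ 1) (i₀ : Fin n) (b : Bool) :
    (sampleWeights fun j => S.x j ^ 2).expect (fun j => mebPhi A η (t + 1) (S.next A η i₀ j b)) ≤
      Real.exp (32 * η ^ 2 - η * ‖S.x‖ ^ 2) * mebPhi A η t S := by
  set q := sampleWeights fun j => S.x j ^ 2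
  set φ : Fin n → ℝ := fun i =>
    Real.exp (η * (-2 * inner ℝ S.total (A i) + t * ‖A i‖ ^ 2)) / S.w i
  set B : Fin n → ℝ := fun i => Real.exp (η * ‖S.x - A i‖ ^ 2 - η * ‖S.x‖ ^ 2) * φ i
  have hB : ∀ i, 0 ≤ B i := fun i =>
    mul_nonneg (Real.exp_nonneg _) (div_nonneg (Real.exp_nonneg _) (hS.w_pos i).le)
  have hj : ∀ j, mebPhi A η (t + 1) (S.next A η i₀ j b) ≤
      ∑ i, B i * (1 - η * mebEstimate A η S.x j i + η ^ 2 * mebEstimate A η S.x j i ^ 2) := by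
    intro j
    refine Finset.sum_le_sum fun i _ => ?_
    have e : Real.exp (η * (-2 * inner ℝ (S.next A η i₀ j b).total (A i) +
        (t + 1 : ℕ) * ‖A i‖ ^ 2)) / (S.next A η i₀ j b).w i =
        B i * (1 + η * mebEstimate A η S.x j i + (η * mebEstimate A η S.x j i) ^ 2)⁻¹ := by
      have : η * (-2 * inner ℝ (S.total + S.x) (A i) + (t + 1 : ℕ) * ‖A i‖ ^ 2) =
          (η * ‖S.x - A i‖ ^ 2 - η * ‖S.x‖ ^ 2) +
            η * (-2 * inner ℝ S.total (A i) + t * ‖A i‖ ^ 2) := by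
        rw [inner_add_left, norm_sub_sq_eq]
        push_cast
        ring
      simp only [MEBState.next, B, φ, this, Real.exp_add, mul_pow]
      rw [mul_div_assoc, div_mul_eq_div_div, div_eq_mul_inv (_ / _), mul_assoc]
    rw [e, ← mul_pow]
    exact mul_le_mul_of_nonneg_left (inv_one_add_add_sq_le _) (hB i)
  refine (expect_mono _ hj).trans ?_
  rw [expect_sum, mebPhi, Finset.mul_sum]
  refine Finset.sum_le_sum fun i _ => ?_
  rw [expect_mul_left, expect_add, expect_sub, expect_const, expect_mul_left, expect_mul_left]
  have h1 := (abs_le.1 (abs_expect_estimate_sub_le hη (hA i) hS.norm_x_le)).1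
  have h2 := expect_estimate_sq_le hη (hA i) hS.norm_x_le
  set v := q.expect fun j => mebEstimate A η S.x j i
  set u := q.expect fun j => mebEstimate A η S.x j i ^ 2
  calc B i * (1 - η * v + η ^ 2 * u)
      ≤ B i * Real.exp (-(η * ‖S.x - A i‖ ^ 2) + 32 * η ^ 2) := by
        refine mul_le_mul_of_nonneg_left ?_ (hB i)
        refine le_trans ?_ (Real.add_one_le_exp _)
        nlinarith [sq_nonneg η]
    _ = _ := by
        simp only [B]
        rw [mul_right_comm, ← Real.exp_add]
        congr 2
        ring

theorem expect_log_mebPhi_le [NeZero n] [NeZero d] {t : ℕ} {S : MEBState n d} (hS : S.Valid t) (hη : 0 < η)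
    (hA : ∀ i, ‖A i‖ ≤ 1) (i₀ : Fin n) (b : Bool) :
    (sampleWeights fun j => S.x j ^ 2).expect
        (fun j => Real.log (mebPhi A η (t + 1) (S.next A η i₀ j b))) ≤
      Real.log (mebPhi A η t S) + 32 * η ^ 2 - η * ‖S.x‖ ^ 2 := by
  have hΦ := mebPhi_pos (A := A) (η := η) hS t
  set K := Real.exp (32 * η ^ 2 - η * ‖S.x‖ ^ 2) * mebPhi A η t S with hK
  have hK0 : 0 < K := by positivity
  -- Jensen's inequality for the logarithm, by its tangent line at the bound `K` of the mean.
  have hj : ∀ j, Real.log (mebPhi A η (t + 1) (S.next A η i₀ j b)) ≤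
      (Real.log K - 1) + K⁻¹ * mebPhi A η (t + 1) (S.next A η i₀ j b) := by
    intro j
    have hp := mebPhi_pos (A := A) (η := η) (hS.next (η := η) hA i₀ j b) (t + 1)
    have := Real.log_le_sub_one_of_pos (div_pos hp hK0)
    rw [Real.log_div hp.ne' hK0.ne', div_eq_inv_mul] at this
    linarith
  refine (expect_mono _ hj).trans ?_
  rw [expect_add, expect_const, expect_mul_left]
  have h1 := mul_le_mul_of_nonneg_left (expect_mebPhi_le (A := A) hS hη hA i₀ b) (inv_nonneg.2 hK0.le)
  rw [← hK, inv_mul_cancel₀ hK0.ne'] at h1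
  have h2 : Real.log K = 32 * η ^ 2 - η * ‖S.x‖ ^ 2 + Real.log (mebPhi A η t S) := by
    rw [hK, Real.log_mul (Real.exp_pos _).ne' hΦ.ne', Real.log_exp]
  linarith

end

/-! ### From the potential to the expected radius at the returned point. -/

section

variable {n d : ℕ} [NeZero n] {A : Fin n → EuclideanSpace ℝ (Fin d)} {η α : ℝ}

/-- The exponential of a row is its summand in `mebPhi` times its weight, hence at most `mebPhi`
times the sum of the weights. With `η ‖total‖ ^ 2 / T` added, the exponent is exactly `η T` times
the squared distance from the mean to the row. The leader potential is at least minus four harmonic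
numbers. -/
theorem sqRadiusAt_le_mebPotential {T : ℕ} (hT : 0 < T) {S : MEBState n d} (hS : S.Valid T)
    (hη : 0 < η) (hα : 0 < α) (z : EuclideanSpace ℝ (Fin d)) :
    η * T * sqRadiusAt A ((T : ℝ)⁻¹ • S.total) ≤ mebPotential A η α z T S +
      η * T * sqRadiusAt A z + η / α * (4 * (1 + Real.log T)) := by
  have hT' : (0 : ℝ) < T := by exact_mod_cast hT
  have hW : 0 < ∑ k, S.w k := Finset.sum_pos (fun i _ => hS.w_pos i) Finset.univ_nonempty
  have hΦ := mebPhi_pos (A := A) (η := η) hS T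
  have hF : -(4 * (1 + Real.log T)) ≤ leaderPotential z S := by
    have h1 : (harmonic S.updates : ℝ) ≤ harmonic T := by
      exact_mod_cast Finset.sum_le_sum_of_subset_of_nonneg
        (Finset.range_subset_range.2 hS.updates_le) fun _ _ _ => by positivity
    have h2 := harmonic_le_one_add_log T
    have h3 : 0 ≤ (S.updates : ℝ) * ‖z - S.x‖ ^ 2 := by positivity
    rw [leaderPotential]
    linarith
  have hF' := mul_le_mul_of_nonneg_left hF (div_nonneg hη.le hα.le)
  have key : ∀ i, ‖(T : ℝ)⁻¹ • S.total - A i‖ ^ 2 ≤ (η * T)⁻¹ * (mebPotential A η α z T S +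
      η * T * sqRadiusAt A z + η / α * (4 * (1 + Real.log T))) := by
    intro i
    rw [le_inv_mul_iff₀ (by positivity)]
    have h1 : η * (-2 * inner ℝ S.total (A i) + T * ‖A i‖ ^ 2) ≤
        Real.log (∑ k, S.w k) + Real.log (mebPhi A η T S) := by
      rw [← Real.log_mul hW.ne' hΦ.ne', Real.le_log_iff_exp_le (by positivity)]
      have h2 : Real.exp (η * (-2 * inner ℝ S.total (A i) + T * ‖A i‖ ^ 2)) / S.w i ≤
          mebPhi A η T S :=
        Finset.single_le_sum (f := fun i =>
          Real.exp (η * (-2 * inner ℝ S.total (A i) + T * ‖A i‖ ^ 2)) / S.w i)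
          (fun i _ => (div_pos (Real.exp_pos _) (hS.w_pos i)).le) (Finset.mem_univ i)
      have h3 : S.w i ≤ ∑ k, S.w k :=
        Finset.single_le_sum (fun i _ => (hS.w_pos i).le) (Finset.mem_univ i)
      rw [div_le_iff₀ (hS.w_pos i)] at h2
      calc _ ≤ mebPhi A η T S * S.w i := h2
        _ ≤ mebPhi A η T S * ∑ k, S.w k := by gcongr
        _ = _ := mul_comm _ _
    have h4 : η * T * ‖(T : ℝ)⁻¹ • S.total - A i‖ ^ 2 =
        η * (-2 * inner ℝ S.total (A i) + T * ‖A i‖ ^ 2) + η * (‖S.total‖ ^ 2 / T) := by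
      rw [norm_sub_sq_eq, inner_smul_left, norm_smul, norm_inv, Real.norm_natCast]
      simp only [conj_trivial]
      field_simp
    rw [h4, mebPotential]
    linarith
  have := ciSup_le key
  rwa [le_inv_mul_iff₀ (by positivity)] at this

variable [NeZero d]

/-- The expectation of `f` after one iteration from the state `S`. -/
noncomputable def stepExpect (A : Fin n → EuclideanSpace ℝ (Fin d)) (η α : ℝ)
    (f : MEBState n d → ℝ) (S : MEBState n d) : ℝ :=
  (sampleWeights S.w).expect fun i => (sampleWeights fun j => S.x j ^ 2).expect fun j =>
    (coin α).expect fun b => f (S.next A η i j b)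

/-- The expectation of `f` after `t` iterations. -/
noncomputable def iterExpect (A : Fin n → EuclideanSpace ℝ (Fin d)) (η α : ℝ) :
    ℕ → (MEBState n d → ℝ) → ℝ
  | 0, f => f (MEBState.init n d)
  | t + 1, f => iterExpect A η α t (stepExpect A η α f)

/-- The potential can be negative, so its expectation is taken as iterated finite real sums,
`iterExpect`; for nonnegative functions these agree with `mean`. -/
theorem mean_mebStep {f : MEBState n d → ℝ} (hf : ∀ S, 0 ≤ f S) (S : MEBState n d) :
    (mebStep A η α S).mean (fun S => ENNReal.ofReal (f S)) =
      ENNReal.ofReal (stepExpect A η α f S) := by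
  rw [mebStep_eq, stepExpect]
  simp only [mean_bind, mean_pure]
  rw [← mean_ofReal _ fun i => expect_nonneg _ fun j => expect_nonneg _ fun b => hf _]
  congr 1
  funext i
  rw [← mean_ofReal _ fun j => expect_nonneg _ fun b => hf _]
  congr 1
  funext j
  rw [← mean_ofReal _ fun b => hf _]

theorem mean_mebIterate (t : ℕ) {f : MEBState n d → ℝ} (hf : ∀ S, 0 ≤ f S) :
    (mebIterate A η α t).mean (fun S => ENNReal.ofReal (f S)) =
      ENNReal.ofReal (iterExpect A η α t f) := by
  induction t generalizing f with
  | zero => rw [mebIterate, mean_pure, iterExpect]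
  | succ t ih =>
    rw [mebIterate, mean_bind, iterExpect, ← ih]
    · simp only [mean_mebStep hf]
    · exact fun S => expect_nonneg _ fun i => expect_nonneg _ fun j => expect_nonneg _ fun b => hf _

theorem iterExpect_mono (hA : ∀ i, ‖A i‖ ≤ 1) (t : ℕ) {f g : MEBState n d → ℝ}
    (h : ∀ S, S.Valid t → f S ≤ g S) : iterExpect A η α t f ≤ iterExpect A η α t g := by
  induction t generalizing f g with
  | zero => exact h _ MEBState.valid_init
  | succ t ih =>
    refine ih fun S hS => ?_
    exact expect_mono _ fun i => expect_mono _ fun j => expect_mono _ fun b => h _ (hS.next hA i j b)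

theorem iterExpect_add_const (t : ℕ) (f : MEBState n d → ℝ) (b : ℝ) :
    iterExpect A η α t (fun S => f S + b) = iterExpect A η α t f + b := by
  induction t generalizing f with
  | zero => rfl
  | succ t ih =>
    rw [iterExpect, iterExpect, ← ih]
    congr 1
    funext S
    simp only [stepExpect, expect_add, expect_const]

theorem iterExpect_mul_left (t : ℕ) (f : MEBState n d → ℝ) (b : ℝ) :
    iterExpect A η α t (fun S => b * f S) = b * iterExpect A η α t f := by
  induction t generalizing f with
  | zero => rfl
  | succ t ih =>
    rw [iterExpect, iterExpect, ← ih]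
    congr 1
    funext S
    simp only [stepExpect, expect_mul_left]

theorem expect_coin {q : ℝ} (h0 : 0 ≤ q) (h1 : q ≤ 1) (f : Bool → ℝ) :
    (coin q).expect f = q * f true + (1 - q) * f false := by
  rw [expect, Fintype.sum_bool, coin_true h1, coin_false h1 h0, ENNReal.toReal_ofReal h0,
    ENNReal.toReal_ofReal (by linarith)]

theorem stepExpect_mebPotential_le {t : ℕ} {S : MEBState n d} (hS : S.Valid t) (hη : 0 < η)
    (hα : 0 < α) (hα1 : α ≤ 1) (hA : ∀ i, ‖A i‖ ≤ 1) (z : EuclideanSpace ℝ (Fin d)) :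
    stepExpect A η α (mebPotential A η α z (t + 1)) S ≤
      mebPotential A η α z t S + 64 * η ^ 2 := by
  set R := sqRadiusAt A z with hR
  set q := sampleWeights fun j => S.x j ^ 2 with hq
  set p := sampleWeights S.w with hp
  have hnext : ∀ i, (q.expect fun j => (coin α).expect fun b =>
      mebPotential A η α z (t + 1) (S.next A η i j b)) ≤
      mebPotential A η α z t S + η * p.expect (fun i => ‖S.x - A i‖ ^ 2) + 64 * η ^ 2 -
        η * ‖S.x - A i‖ ^ 2 := by
    intro i
    have hF : ∀ j, (coin α).expect (fun b => η / α * leaderPotential z (S.next A η i j b)) ≤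
        η / α * leaderPotential z S + η * (R - ‖S.x - A i‖ ^ 2) := by
      intro j
      rw [expect_mul_left, expect_coin hα.le hα1]
      have h1 := leaderPotential_update (η := η) hS hA z i j
      have h2 : leaderPotential z (S.next A η i j false) = leaderPotential z S := rfl
      calc _ ≤ η / α * (α * (leaderPotential z S + (R - ‖S.x - A i‖ ^ 2)) +
            (1 - α) * leaderPotential z S) := by
            rw [h2]
            gcongr
        _ = _ := by
            field_simp
            ring
    have hW := expect_log_weights_le hS hη hA i true
    have hΦ := expect_log_mebPhi_le hS hη hA i true
    have hQ := norm_total_sq_div_le hS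
    have hj : ∀ j, (coin α).expect (fun b => mebPotential A η α z (t + 1) (S.next A η i j b)) ≤
        Real.log (∑ r, (S.next A η i j true).w r) +
        Real.log (mebPhi A η (t + 1) (S.next A η i j true)) +
        (η * (‖S.total‖ ^ 2 / t + ‖S.x‖ ^ 2) +
          (η / α * leaderPotential z S + η * (R - ‖S.x - A i‖ ^ 2)) - η * (t + 1) * R) := by
      intro j
      -- The coin affects only the leader potential; weights and total are the same for both
      -- outcomes.
      have e : ∀ b, mebPotential A η α z (t + 1) (S.next A η i j b) =
          (Real.log (∑ r, (S.next A η i j true).w r) +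
          Real.log (mebPhi A η (t + 1) (S.next A η i j true)) +
          η * (‖S.total + S.x‖ ^ 2 / (t + 1 : ℕ)) - η * (t + 1 : ℕ) * R) +
          η / α * leaderPotential z (S.next A η i j b) := by
        intro b
        rw [mebPotential]
        change Real.log (∑ r, (S.next A η i j true).w r) +
          Real.log (mebPhi A η (t + 1) (S.next A η i j true)) +
          η * (‖S.total + S.x‖ ^ 2 / (t + 1 : ℕ)) +
          η / α * leaderPotential z (S.next A η i j b) - η * (t + 1 : ℕ) * R = _
        ring
      simp only [e]
      rw [expect_add, expect_const]
      have := hF j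
      have h3 := mul_le_mul_of_nonneg_left hQ hη.le
      push_cast at h3 ⊢
      linarith
    refine (expect_mono _ hj).trans ?_
    rw [expect_add, expect_add, expect_const, mebPotential]
    nlinarith
  rw [stepExpect]
  refine (expect_mono _ hnext).trans (le_of_eq ?_)
  rw [expect_sub, expect_const, expect_mul_left]
  ring

theorem iterExpect_mebPotential_le (hη : 0 < η) (hα : 0 < α) (hα1 : α ≤ 1) (hA : ∀ i, ‖A i‖ ≤ 1)
    (z : EuclideanSpace ℝ (Fin d)) (t : ℕ) :
    iterExpect A η α t (mebPotential A η α z t) ≤ 2 * Real.log n + t * (64 * η ^ 2) := by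
  induction t with
  | zero => simp [iterExpect, mebPotential_init]
  | succ t ih =>
    rw [iterExpect]
    refine (iterExpect_mono hA t fun S hS =>
      stepExpect_mebPotential_le hS hη hα hα1 hA z).trans ?_
    rw [iterExpect_add_const]
    push_cast
    linarith

theorem iterExpect_sqRadiusAt_le {T : ℕ} (hT : 0 < T) (hη : 0 < η) (hα : 0 < α) (hα1 : α ≤ 1)
    (hA : ∀ i, ‖A i‖ ≤ 1) :
    iterExpect A η α T (fun S => sqRadiusAt A ((T : ℝ)⁻¹ • S.total)) ≤ mebSqRadius A +
      (2 * Real.log n + T * (64 * η ^ 2) + η / α * (4 * (1 + Real.log T))) / (η * T) := by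
  have hT' : (0 : ℝ) < T := by exact_mod_cast hT
  rw [← sub_le_iff_le_add]
  -- The bound holds against each fixed `z`; the infimum is taken last and need not be attained.
  refine le_ciInf fun z => ?_
  rw [sub_le_iff_le_add, ← sub_le_iff_le_add', le_div_iff₀' (by positivity), mul_sub,
    ← iterExpect_mul_left, sub_le_iff_le_add]
  refine (iterExpect_mono hA T fun S hS => ?_).trans ((iterExpect_add_const (A := A) (η := η)
    (α := α) T (mebPotential A η α z T) (η * T * sqRadiusAt A z +
      η / α * (4 * (1 + Real.log T)))).le.trans ?_)
  · have := sqRadiusAt_le_mebPotential (A := A) hT hS hη hα z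
    linarith
  · have := iterExpect_mebPotential_le hη hα hα1 hA z T
    linarith

end

/-! ### The parameters -/

theorem le_mebIterations {n : ℕ} {ε : ℝ} (hε : 0 < ε) :
    40000 * Real.log n ≤ mebIterations 40000 n ε * ε ^ 2 := by
  rw [← div_le_iff₀ (by positivity)]
  exact Nat.le_ceil _

theorem mebIterations_pos {n : ℕ} (hn : 2 ≤ n) {ε : ℝ} (hε : 0 < ε) :
    0 < mebIterations 40000 n ε := by
  have := half_lt_log hn
  exact Nat.ceil_pos.2 (by positivity)

theorem one_le_log_mebIterations {n : ℕ} (hn : 2 ≤ n) {ε : ℝ} (hε : 0 < ε) (h4 : ε < 4) :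
    1 ≤ Real.log (mebIterations 40000 n ε) := by
  have h := le_mebIterations (n := n) hε
  have hl := half_lt_log hn
  have hT : (0 : ℝ) < mebIterations 40000 n ε := by exact_mod_cast mebIterations_pos hn hε
  rw [Real.le_log_iff_exp_le hT]
  have := Real.exp_one_lt_d9
  have h16 : ε ^ 2 ≤ 16 := by nlinarith
  nlinarith

/-- Makes `α ≤ 1`, so that the coin is not truncated. From `log u ≤ u / e` at `u = √T` one gets
`(log T) ^ 2 ≤ (4 / e ^ 2) T`, and `4 / e ^ 2 < 0.69 < log 2`. -/
theorem log_le_sqrt_mul_log {n T : ℕ} (hn : 2 ≤ n) (hT : 0 < T) :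
    Real.log T ≤ Real.sqrt (T * Real.log n) := by
  have hT' : (0 : ℝ) < T := by exact_mod_cast hT
  have hs : 0 < Real.sqrt T := Real.sqrt_pos.2 hT'
  have he : 2.71 < Real.exp 1 := by
    have := Real.exp_one_gt_d9
    norm_num at this ⊢
    linarith
  have h1 : Real.log T = 2 * Real.log (Real.sqrt T) := by
    rw [Real.log_sqrt hT'.le]
    ring
  have h2 : Real.log (Real.sqrt T) ≤ Real.sqrt T / Real.exp 1 := by
    have := Real.log_le_sub_one_of_pos (div_pos hs (Real.exp_pos 1))
    rw [Real.log_div hs.ne' (Real.exp_pos 1).ne', Real.log_exp] at this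
    linarith
  have h3 : Real.sqrt T / Real.exp 1 ≤ Real.sqrt T / 2.71 := by gcongr
  have hl : 0.69 ≤ Real.log n := by
    have h := Real.log_two_gt_d9
    have h' := Real.log_le_log two_pos (show (2 : ℝ) ≤ n by exact_mod_cast hn)
    norm_num at h ⊢
    linarith
  rw [h1]
  refine Real.le_sqrt_of_sq_le ?_
  have h5 : 2 * Real.log (Real.sqrt T) ≤ 2 * (Real.sqrt T / 2.71) := by linarith
  have h6 : 0 ≤ 2 * Real.log (Real.sqrt T) := by
    rw [← h1]
    exact Real.log_natCast_nonneg T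
  calc (2 * Real.log (Real.sqrt T)) ^ 2 ≤ (2 * (Real.sqrt T / 2.71)) ^ 2 := by gcongr
    _ = (T : ℝ) * (4 / 2.71 ^ 2) := by
        rw [mul_pow, div_pow, Real.sq_sqrt hT'.le]
        ring
    _ ≤ T * Real.log n := by
        gcongr
        refine le_trans ?_ hl
        norm_num

theorem regret_le_half {n : ℕ} (hn : 2 ≤ n) {ε : ℝ} (hε : 0 < ε) (h4 : ε < 4) {T : ℕ}
    (hT : T = mebIterations 40000 n ε) :
    (2 * Real.log n + T * (64 * mebEta n T ^ 2) +
      mebEta n T / mebAlpha n T * (4 * (1 + Real.log T))) / (mebEta n T * T) ≤ ε / 2 := by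
  have hlT : 1 ≤ Real.log T := hT ▸ one_le_log_mebIterations hn hε h4
  have hT' : (0 : ℝ) < T := by exact_mod_cast hT ▸ mebIterations_pos hn hε
  have hTε : 40000 * Real.log n ≤ T * ε ^ 2 := hT ▸ le_mebIterations hε
  have hl : 0 < Real.log n := by linarith [half_lt_log hn]
  set l := Real.log n
  have hs : 0 < Real.sqrt (T * l) := by positivity
  have hs2 : Real.sqrt (T * l) ^ 2 = T * l := Real.sq_sqrt (by positivity)
  obtain ⟨s, hsdef⟩ : ∃ s, s = Real.sqrt (T * l) := ⟨_, rfl⟩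
  rw [← hsdef] at hs hs2
  have hη : mebEta n T = s / T := by
    change Real.sqrt (l / T) = _
    rw [Real.sqrt_eq_iff_mul_self_eq (by positivity) (by positivity)]
    field_simp
    linear_combination -hs2
  have hα : mebAlpha n T = Real.log T / s := by rw [hsdef, mebAlpha]
  have e1 : T * (64 * mebEta n T ^ 2) = 64 * l := by
    rw [hη]
    field_simp
    linear_combination hs2
  have e2 : mebEta n T / mebAlpha n T = l / Real.log T := by
    rw [hη, hα]
    field_simp
    linear_combination hs2
  have e3 : mebEta n T * T = s := by
    rw [hη]
    field_simp
  have e4 : l / Real.log T * (4 * (1 + Real.log T)) ≤ 8 * l := by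
    rw [div_mul_eq_mul_div, div_le_iff₀ (by linarith)]
    nlinarith
  rw [e1, e2, e3, div_le_iff₀ hs]
  -- The numerator is at most `2 l + 64 l + 8 l = 74 l`. Since `s ^ 2 = T l` and `T ε ^ 2 ≥ 40000
  -- l`, even `200 l ≤ ε s` holds; this fixes the constant `40000`.
  have h148 : 148 * l ≤ ε * s := by
    refine le_of_sq_le_sq ?_ (by positivity)
    rw [mul_pow, mul_pow, hs2]
    nlinarith
  linarith

/-! ### The success probability -/

theorem mebSqRadius_le_sqRadiusAt {n d : ℕ} [NeZero n] (A : Fin n → EuclideanSpace ℝ (Fin d))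
    (x : EuclideanSpace ℝ (Fin d)) : mebSqRadius A ≤ sqRadiusAt A x :=
  ciInf_le ⟨0, by
    rintro _ ⟨y, rfl⟩
    exact Real.iSup_nonneg fun i => by positivity⟩ x

theorem mebSqRadius_nonneg {n d : ℕ} (A : Fin n → EuclideanSpace ℝ (Fin d)) : 0 ≤ mebSqRadius A :=
  Real.iInf_nonneg fun _ => Real.iSup_nonneg fun i => by positivity

theorem half_le_success {n d : ℕ} [NeZero n] [NeZero d] {A : Fin n → EuclideanSpace ℝ (Fin d)}
    {ε : ℝ} (hn : 2 ≤ n) (hA : ∀ i, ‖A i‖ ≤ 1) (hε : 0 < ε) :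
    1 / 2 ≤ (mebOutput 40000 A ε).toOuterMeasure {x | IsApproxMEBCenter A ε x} := by
  have hTpos := mebIterations_pos hn hε
  rw [← mean_indicator, mebOutput, mean_map]
  set T := mebIterations 40000 n ε with hT
  have hT' : (0 : ℝ) < T := by exact_mod_cast hTpos
  set good : Set (EuclideanSpace ℝ (Fin d)) := {x | IsApproxMEBCenter A ε x} with hgood
  set f : MEBState n d → ℝ := fun S => good.indicator 1 ((T : ℝ)⁻¹ • S.total) with hf
  have hf0 : ∀ S, 0 ≤ f S := fun S => Set.indicator_nonneg (fun _ _ => zero_le_one) _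
  have hmean : (mebIterate A (mebEta n T) (mebAlpha n T) T).mean
      (fun S => good.indicator 1 ((T : ℝ)⁻¹ • S.total)) =
      ENNReal.ofReal (iterExpect A (mebEta n T) (mebAlpha n T) T f) := by
    rw [← mean_mebIterate T hf0]
    congr 1
    funext S
    by_cases h : (T : ℝ)⁻¹ • S.total ∈ good <;> simp [f, h]
  have hhalf : (1 / 2 : ℝ≥0∞) = ENNReal.ofReal (1 / 2) := by
    rw [ENNReal.ofReal_div_of_pos two_pos]
    simp
  refine (hhalf.trans_le (ENNReal.ofReal_le_ofReal ?_)).trans hmean.ge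
  -- For large `ε` there may be a single iteration, and then `α = 0`; that range is settled by the
  -- diameter of the unit ball.
  rcases lt_or_ge ε 4 with h4 | h4
  · have hl : 0 < Real.log n := by linarith [half_lt_log hn]
    have hlT : 1 ≤ Real.log T := one_le_log_mebIterations hn hε h4
    have hη : 0 < mebEta n T := Real.sqrt_pos.2 (by positivity)
    have hs : 0 < Real.sqrt (T * Real.log n) := Real.sqrt_pos.2 (by positivity)
    have hα : 0 < mebAlpha n T := div_pos (by linarith) hs
    have hα1 : mebAlpha n T ≤ 1 := (div_le_one hs).2 (log_le_sqrt_mul_log hn hTpos)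
    have hE := iterExpect_sqRadiusAt_le (A := A) hTpos hη hα hα1 hA
    have hR := regret_le_half hn hε h4 hT
    -- Markov's inequality in pointwise form: one minus the excess divided by `ε` is at most the
    -- indicator of success.
    have hpt : ∀ S : MEBState n d,
        -ε⁻¹ * sqRadiusAt A ((T : ℝ)⁻¹ • S.total) + (1 + ε⁻¹ * mebSqRadius A) ≤ f S := by
      intro S
      have hX := mebSqRadius_le_sqRadiusAt A ((T : ℝ)⁻¹ • S.total)
      have hε' : 0 < ε⁻¹ := inv_pos.2 hε
      by_cases h : (T : ℝ)⁻¹ • S.total ∈ good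
      · simp only [f, Set.indicator_of_mem h, Pi.one_apply]
        nlinarith
      · simp only [f, Set.indicator_of_notMem h]
        have h' : mebSqRadius A + ε < sqRadiusAt A ((T : ℝ)⁻¹ • S.total) := not_le.1 h
        have : ε⁻¹ * ε = 1 := inv_mul_cancel₀ hε.ne'
        nlinarith
    refine le_trans ?_ (iterExpect_mono hA T fun S _ => hpt S)
    rw [iterExpect_add_const, iterExpect_mul_left]
    have h := mul_le_mul_of_nonneg_left (hE.trans (add_le_add_right hR _)) (inv_pos.2 hε).le
    have : ε⁻¹ * (ε / 2) = 1 / 2 := by field_simp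
    linarith
  · have hpt : ∀ S : MEBState n d, S.Valid T → (0 : ℝ) * 0 + 1 ≤ f S := by
      intro S hS
      have h : (T : ℝ)⁻¹ • S.total ∈ good := by
        refine le_trans (ciSup_le fun i => norm_sub_sq_le_four ?_ (hA i))
          (h4.trans (le_add_of_nonneg_left (mebSqRadius_nonneg A)))
        rw [norm_smul, norm_inv, Real.norm_natCast, inv_mul_le_one₀ hT']
        exact hS.norm_total_le
      simp [f, h]
    refine le_trans ?_ (iterExpect_mono (A := A) (η := mebEta n T) (α := mebAlpha n T) hA T hpt)
    rw [iterExpect_add_const T (fun _ => (0 : ℝ) * 0) 1, iterExpect_mul_left T (fun _ => 0) 0]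
    norm_num

theorem mainTheorem3 :
    ∃ (c C : ℝ) (k : ℕ) (P : RAMProgram), 0 < c ∧
      ∀ (n d : ℕ) [NeZero n] [NeZero d] (A : Fin n → EuclideanSpace ℝ (Fin d)) (ε : ℝ),
        2 ≤ n → (∀ i, ‖A i‖ ≤ 1) → 0 < ε →
          -- the program realizes the algorithm
          P.output (mebInput A ε) d = mebOutput c A ε ∧
          -- the number of iterations and the expected running time
          (ε ≤ 1 →
            (mebIterations c n ε : ℝ) ≤ C * (Real.log n / ε ^ 2) ∧
            P.expectedTime (mebInput A ε) ≤
              ENNReal.ofReal (C * (n / ε ^ 2 + d / ε) * Real.log (n * d / ε) ^ k)) ∧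
          -- success with probability at least one half
          1 / 2 ≤ (mebOutput c A ε).toOuterMeasure {x | IsApproxMEBCenter A ε x} := by
  refine ⟨40000, 10 ^ 10, 2, MEBProgram.program, by norm_num, fun n d _ _ A ε hn hA hε =>
    ⟨(MEBProgram.sim_program A ε).output_eq, fun h1 => ⟨?_, expectedTime_program_le A hn hε h1⟩,
      half_le_success hn hA hε⟩⟩
  refine (mebIterations_le hn hε h1).trans ?_
  have : 0 ≤ Real.log n / ε ^ 2 := div_nonneg (Real.log_natCast_nonneg n) (sq_nonneg ε)
  gcongr
  norm_num
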